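/- Let $4<p<\infty$. All spaces are real, and $L_p(\mathbb R)$, $L_p[0,1]$ are taken with respect to Lebesgue measure. For $f\in L_p(\mathbb R)$ and $\lambda\in\mathbb R$ write $f_{(\lambda)}(x)=f(x-\lambda)$, and for $\Lambda\subseteq\mathbb R$ let $X_p(f,\Lambda)$ be the closed linear span of $\{f_{(\lambda)}:\lambda\in\Lambda\}$ in $L_p(\mathbb R)$. Let $\Lambda=\{-3^j : j=1,2,3,\dots\}\subseteq\mathbb Z$. Then there exists $f\in L_p(\mathbb R)$ such that $(f_{(\lambda)})_{\lambda\in\Lambda}$ is an unconditional basic sequence, i.e. an unconditional Schauder basis of $X_p(f,\Lambda)$, and such that $X_p(f,\Lambda)$ contains an isomorph of $L_p(\mathbb R)$. More precisely, there is a block basis $(b_n)_{n\ge1}$ of the sequence $(f_{(-3^j)})_{j\ge1}$, that is, $b_n=\sum_{j=m_{n-1}+1}^{m_n}a_jf_{(-3^j)}\neq0$ for some integers $0\le m_0<m_1<m_2<\cdots$ and real scalars $(a_j)$, with the following two properties. (1) $(b_n)$ is equivalent to the $L_p$-normalized Haar basis $(h_n)_{n\ge1}$ of $L_p[0,1]$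 (in its usual order): there is a constant $C$ such that for all $N$ and all real $c_1,\dots,c_N$, $$C^{-1}\Big\|\sum_{n=1}^N c_nh_n\Big\|_p\le\Big\|\sum_{n=1}^N c_nb_n\Big\|_p\le C\Big\|\sum_{n=1}^N c_nh_n\Big\|_p .$$ (2) The closed linear span of $(b_n)$, which is a subspace of $X_p(f,\Lambda)$, is linearly homeomorphic to $L_p(\mathbb R)$. -/

import Mathlib

open MeasureTheory Set
open scoped ENNReal

noncomputable section

namespace LpTranslates

/-- The closed linear span `[x_i : i ∈ ι]` of a family of vectors. -/
def closedSpan {ι E : Type*} [NormedAddCommGroup E] [NormedSpace ℝ E] (x : ι → E) :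
    Submodule ℝ E :=
  (Submodule.span ℝ (range x)).topologicalClosure

/-- The family `x` is unconditional basic: it is an unconditional Schauder basis of its
closed linear span. -/
def IsUnconditionalBasic {ι E : Type*} [NormedAddCommGroup E] [NormedSpace ℝ E]
    (x : ι → E) : Prop :=
  ∃ b : UnconditionalSchauderBasis ι ℝ (closedSpan x), ∀ i, (b i : E) = x i

/-- `y` is a block basis of the sequence `x`: a sequence of nonzero linear combinations of
`x` over successive intervals of indices. -/
def IsBlockBasis {E : Type*} [NormedAddCommGroup E] [NormedSpace ℝ E] (x y : ℕ → E) : Prop :=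
  ∃ (n : ℕ → ℕ) (a : ℕ → ℝ), StrictMono n ∧
    ∀ i, y i ≠ 0 ∧ y i = ∑ j ∈ Finset.Ico (n i) (n (i + 1)), a j • x j

/-- Equivalence of sequences in two normed spaces: linear combinations with the same finitely
many coefficients have comparable norms, with a uniform constant. -/
def SeqEquivalent {E F : Type*} [NormedAddCommGroup E] [NormedSpace ℝ E]
    [NormedAddCommGroup F] [NormedSpace ℝ F] (x : ℕ → E) (y : ℕ → F) : Prop :=
  ∃ C : ℝ, ∀ (N : ℕ) (a : ℕ → ℝ),
    ‖∑ i ∈ Finset.range N, a i • x i‖ ≤ C * ‖∑ i ∈ Finset.range N, a i • y i‖ ∧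
    ‖∑ i ∈ Finset.range N, a i • y i‖ ≤ C * ‖∑ i ∈ Finset.range N, a i • x i‖

/-- The translate `x ↦ f (x - t)` of `f ∈ L_p(ℝ)`. -/
def translateLp {p : ℝ≥0∞} (f : Lp ℝ p (volume : Measure ℝ)) (t : ℝ) :
    Lp ℝ p (volume : Measure ℝ) :=
  Lp.compMeasurePreserving (fun x : ℝ => x - t) (measurePreserving_sub_right volume t) f

/-- `X_p(f, Λ)`: the closed linear span in `L_p(ℝ)` of the translates of `f` by `Λ ⊆ ℤ`. -/
def translateSpan {p : ℝ≥0∞} [Fact (1 ≤ p)] (f : Lp ℝ p (volume : Measure ℝ)) (Λ : Set ℤ) :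
    Submodule ℝ (Lp ℝ p (volume : Measure ℝ)) :=
  closedSpan fun l : Λ => translateLp f ((l : ℤ) : ℝ)

/-- Lebesgue measure on `[0, 1]`. -/
abbrev unitMeasure : Measure ℝ := volume.restrict (Icc (0 : ℝ) 1)

/-- The dyadic Haar function on `[m / 2 ^ k, (m + 1) / 2 ^ k)`: it is `1` on the left half,
`-1` on the right half, and `0` elsewhere. -/
def dyadicHaar (k m : ℕ) : ℝ → ℝ :=
  (Ico ((m : ℝ) / 2 ^ k) (((m : ℝ) + 1 / 2) / 2 ^ k)).indicator 1 -
    (Ico (((m : ℝ) + 1 / 2) / 2 ^ k) (((m : ℝ) + 1) / 2 ^ k)).indicator 1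

/-- The (unnormalized) Haar system in its usual order, indexed from `0`: first the constant `1`
on `[0, 1]`, and for `n = 2 ^ k + m` with `m < 2 ^ k` the function `dyadicHaar k m`. -/
def haarFun (n : ℕ) : ℝ → ℝ :=
  if n = 0 then (Icc (0 : ℝ) 1).indicator 1
  else dyadicHaar (Nat.log 2 n) (n - 2 ^ Nat.log 2 n)

theorem memLp_haarFun (p : ℝ≥0∞) (n : ℕ) : MemLp (haarFun n) p unitMeasure := by
  have key : ∀ s : Set ℝ, MeasurableSet s → MemLp (s.indicator (1 : ℝ → ℝ)) p unitMeasure :=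
    fun s hs => (memLp_const (1 : ℝ)).indicator hs
  unfold haarFun
  split_ifs
  · exact key _ measurableSet_Icc
  · exact (key _ measurableSet_Ico).sub (key _ measurableSet_Ico)

/-- The `n`-th Haar function as an element of `L_p[0, 1]`. -/
def haarLp (p : ℝ≥0∞) (n : ℕ) : Lp ℝ p unitMeasure :=
  (memLp_haarFun p n).toLp (haarFun n)

/-- The Haar basis of `L_p[0, 1]`, normalized in `L_p`. -/
def normalizedHaar (p : ℝ≥0∞) (n : ℕ) : Lp ℝ p unitMeasure :=
  ‖haarLp p n‖⁻¹ • haarLp p n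

end LpTranslates

end

open LpTranslates

noncomputable section

namespace LpTranslates

/-! ### Pointwise inequalities -/

/-! Write p = 2q and let `h_n` be the L_p-normalized Haar functions. Choose integers `K n ≥ 1` and
cut ℕ into consecutive blocks, the n-th of length `K n ^ 4`. For j in block n let g_j = `(K n)⁻¹ ·
h_n · r_{j+2}` on [0,1), with r a Rademacher function, and let f carry a copy of g_j on [3^(j+1),
3^(j+1)+1) for every j. Since the p-th powers of the norms of the g_j add up to ∑ K_n^(4-p), f lies
in L_p once this series converges, and because p > 4 the `K n` can be taken so large that it does.

The translate f_i by -3^(i+1) equals g_i on [0,1). Differences of powers of 3 are distinct unless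
zero, so off [0,1) the f_i have disjoint supports. Hence (`norm_sum_glueTranslate`) ‖∑ a_i f_i‖^p =
∫ |∑ a_i g_i|^p + ∑ |a_i|^p t_i, where t_i ≤ ‖f‖^p is a tail mass. The g_i are conditionally
symmetric martingale differences, so by the square function inequality
(`SignSymmetric.square_function`) the first summand is comparable to ∫ (∑ a_i² g_i²)^q. This and the
tail sum are monotone in the index set, which gives unconditionality.

Take b_n = `(K n)⁻¹` ∑ f_j over block n. In the square function of ∑ c_n b_n on [0,1), block n
contributes K_n^4 · K_n^(-2) · K_n^(-2) c_n² h_n² = c_n² h_n², exactly the square function of ∑ c_n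
h_n. The tails add at most ‖f‖^p ∑ K_n^(4-p) |c_n|^p, which is dominated by the Haar norm. So (b_n)
is equivalent to the Haar basis (`seqEquivalent_blockVec`), whose closed span L_p[0,1] is isometric
to L_p(ℝ).

The square function inequality is proved by Bellman functions: U(x, s) decreases on average under
(x, s) ↦ (x ± t, s + t²), and measure-preserving maps that flip one difference supply the averaging.
-/

theorem rpow_sub_rpow_le {a b r : ℝ} (ha : 0 ≤ a) (hb : 0 ≤ b) (hr : 1 ≤ r) :
    a ^ r - b ^ r ≤ r * a ^ (r - 1) * (a - b) := by
  rcases ha.eq_or_lt with rfl | ha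
  · have h0 : (0 : ℝ) ^ r = 0 := Real.zero_rpow (by linarith)
    have hb' : 0 ≤ b ^ r := Real.rpow_nonneg hb r
    rcases hr.eq_or_lt with rfl | hr
    · simp
    · rw [h0, Real.zero_rpow (by linarith)]
      simpa using hb'
  -- Bernoulli's inequality at `b / a - 1`, scaled by `a ^ r`: the graph of the convex power lies
  -- above its tangent at `a`.
  · have h := one_add_mul_self_le_rpow_one_add (s := b / a - 1)
      (by linarith [div_nonneg hb ha.le]) hr
    have e1 : (1 + (b / a - 1)) = b / a := by ring
    rw [e1, Real.div_rpow hb ha.le, le_div_iff₀ (Real.rpow_pos_of_pos ha r)] at h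
    have e2 : a ^ r = a ^ (r - 1) * a := by
      rw [← Real.rpow_add_one ha.ne']; ring_nf
    have e3 : (1 + r * (b / a - 1)) * a ^ r = a ^ r + r * a ^ (r - 1) * (b - a) := by
      rw [e2]; field_simp
    linarith [e3 ▸ h]

/-- Either `v` dominates `2 * A * u`, or `v` may be replaced by it. The factor 1/2 lets the `v` term
be absorbed later. -/
theorem mul_mul_rpow_le {u v A r : ℝ} (hu : 0 ≤ u) (hv : 0 ≤ v) (hA : 0 ≤ A) (hr : 1 ≤ r) :
    A * u * v ^ (r - 1) ≤ v ^ r / 2 + A * (2 * A) ^ (r - 1) * u ^ r := by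
  have hur : 0 ≤ u ^ r := Real.rpow_nonneg hu r
  have hvr : 0 ≤ v ^ r := Real.rpow_nonneg hv r
  have hA' : 0 ≤ (2 * A) ^ (r - 1) := Real.rpow_nonneg (by linarith) _
  have key : ∀ {w : ℝ}, 0 ≤ w → w * w ^ (r - 1) = w ^ r := by
    intro w hw
    conv_lhs => rw [mul_comm, ← Real.rpow_add_one' hw (by linarith)]
    ring_nf
  by_cases h : 2 * A * u ≤ v
  · calc A * u * v ^ (r - 1) ≤ (v / 2) * v ^ (r - 1) := by
          gcongr; linarith
      _ = v ^ r / 2 := by rw [← key hv]; ring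
      _ ≤ _ := by linarith [mul_nonneg (mul_nonneg hA hA') hur]
  · calc A * u * v ^ (r - 1) ≤ A * u * (2 * A * u) ^ (r - 1) := by
          gcongr
          exact (not_le.1 h).le
      _ = A * (2 * A) ^ (r - 1) * u ^ r := by
          rw [Real.mul_rpow (by linarith) hu, ← key hu]; ring
      _ ≤ _ := by linarith

theorem abs_rpow_mul_sub_le (y z : ℝ) {r : ℝ} (hr : 1 ≤ r) :
    (|y| ^ r * y - |z| ^ r * z) * (y - z) ≤ (r + 1) * (|y| ^ r + |z| ^ r) * (y - z) ^ 2 := by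
  wlog hle : |z| ≤ |y| generalizing y z
  · have := this z y (le_of_not_ge hle)
    linarith
  have hy : 0 ≤ |y| ^ r := by positivity
  have h1 : |z| * (|y| ^ r - |z| ^ r) ≤ r * |y| ^ r * (|y| - |z|) := by
    have e : |y| ^ r = |y| ^ (r - 1) * |y| := by
      rw [← Real.rpow_add_one' (abs_nonneg y) (by linarith)]; ring_nf
    calc |z| * (|y| ^ r - |z| ^ r) ≤ |y| * (|y| ^ r - |z| ^ r) := by
          apply mul_le_mul_of_nonneg_right hle
          exact sub_nonneg.2 (Real.rpow_le_rpow (abs_nonneg z) hle (by linarith))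
      _ ≤ |y| * (r * |y| ^ (r - 1) * (|y| - |z|)) :=
          mul_le_mul_of_nonneg_left (rpow_sub_rpow_le (abs_nonneg y) (abs_nonneg z) hr)
            (abs_nonneg y)
      _ = r * |y| ^ r * (|y| - |z|) := by rw [e]; ring
  have h2 : |y| - |z| ≤ |y - z| := abs_sub_abs_le_abs_sub y z
  have h3 : 0 ≤ |y| ^ r - |z| ^ r :=
    sub_nonneg.2 (Real.rpow_le_rpow (abs_nonneg z) hle (by linarith))
  have h4 : z * (y - z) * (|y| ^ r - |z| ^ r) ≤ |z| * |y - z| * (|y| ^ r - |z| ^ r) := by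
    refine mul_le_mul_of_nonneg_right ?_ h3
    rw [← abs_mul]; exact le_abs_self _
  have h5 : |y - z| * (|z| * (|y| ^ r - |z| ^ r)) ≤ |y - z| * (r * |y| ^ r * |y - z|) :=
    mul_le_mul_of_nonneg_left (h1.trans (by gcongr)) (abs_nonneg _)
  have h6 : |y - z| * |y - z| = (y - z) ^ 2 := by rw [abs_mul_abs_self]; ring
  have h7 : |y - z| * (r * |y| ^ r * |y - z|) = r * |y| ^ r * (y - z) ^ 2 := by
    rw [← h6]; ring
  have h8 : 0 ≤ |z| ^ r * (y - z) ^ 2 := by positivity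
  have h9 : 0 ≤ r * |z| ^ r * (y - z) ^ 2 := by positivity
  linarith

/-- Adding the tangent inequalities at `x + d` and `x - d` leaves an increment of `|y| ^ r * y`,
which `abs_rpow_mul_sub_le` makes quadratic in `d`. -/
theorem abs_rpow_add_abs_rpow_sub_le (x d : ℝ) {r : ℝ} (hr : 1 ≤ r) :
    |x + d| ^ (r + 2) + |x - d| ^ (r + 2) ≤ 2 * |x| ^ (r + 2) +
      2 * (r + 2) * (r + 1) * d ^ 2 * (|x + d| ^ r + |x - d| ^ r) := by
  have tangent : ∀ y : ℝ, |y| ^ (r + 2) - |x| ^ (r + 2) ≤ (r + 2) * |y| ^ r * y * (y - x) := by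
    intro y
    have h := rpow_sub_rpow_le (abs_nonneg y) (abs_nonneg x) (r := r + 2) (by linarith)
    have e : |y| ^ (r + 2 - 1) = |y| ^ r * |y| := by
      rw [← Real.rpow_add_one' (abs_nonneg y) (by linarith)]; ring_nf
    have h2 : |y| * (|y| - |x|) ≤ y * (y - x) := by
      nlinarith [abs_mul_abs_self y, le_abs_self (y * x), abs_mul y x]
    have h3 : 0 ≤ (r + 2) * |y| ^ r := by positivity
    rw [e] at h
    nlinarith [mul_le_mul_of_nonneg_left h2 h3]
  set y := x + d
  set z := x - d
  have hyz : y - z = 2 * d := by simp only [y, z]; ring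
  have hy : 0 ≤ |y| ^ r := by positivity
  have hz : 0 ≤ |z| ^ r := by positivity
  have bound := abs_rpow_mul_sub_le y z hr
  have t1 := tangent y
  have t2 := tangent z
  have e1 : y - x = d := by simp only [y]; ring
  have e2 : z - x = -d := by simp only [z]; ring
  rw [e1] at t1
  rw [e2] at t2
  rw [hyz] at bound
  have h10 : (r + 2) * ((|y| ^ r * y - |z| ^ r * z) * (2 * d)) ≤
    (r + 2) * ((r + 1) * (|y| ^ r + |z| ^ r) * (2 * d) ^ 2) := by gcongr
  nlinarith

theorem abs_rpow_le_midpoint (x d : ℝ) {r : ℝ} (hr : 1 ≤ r) :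
    2 * |x| ^ r ≤ |x + d| ^ r + |x - d| ^ r := by
  have h := (convexOn_rpow hr).2 (abs_nonneg (x + d)) (abs_nonneg (x - d))
    (by norm_num : (0 : ℝ) ≤ 1 / 2) (by norm_num : (0 : ℝ) ≤ 1 / 2) (by norm_num)
  have h2 : |x| ≤ 1 / 2 * |x + d| + 1 / 2 * |x - d| := by
    have := abs_add_le (x + d) (x - d)
    rw [show x + d + (x - d) = 2 * x by ring, abs_mul, abs_two] at this
    linarith
  have h3 := Real.rpow_le_rpow (abs_nonneg x) h2 (by linarith : (0 : ℝ) ≤ r)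
  simp only [smul_eq_mul] at h
  linarith

/-- The Bellman function s^q - q x² s^(q-1), which bounds the square function by the sum. As (x+d)²
+ (x-d)² = 2x² + 2d², the tangent inequality for the q-th power suffices. -/
theorem rpow_sub_mul_rpow_midpoint {s : ℝ} (hs : 0 ≤ s) (x d : ℝ) {q : ℝ} (hq : 1 ≤ q) :
    ((s + d ^ 2) ^ q - q * (x + d) ^ 2 * (s + d ^ 2) ^ (q - 1)) +
      ((s + d ^ 2) ^ q - q * (x - d) ^ 2 * (s + d ^ 2) ^ (q - 1)) ≤
      2 * (s ^ q - q * x ^ 2 * s ^ (q - 1)) := by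
  have hs' : 0 ≤ s + d ^ 2 := by positivity
  have h1 := rpow_sub_rpow_le hs' hs hq
  have h2 : q * x ^ 2 * s ^ (q - 1) ≤ q * x ^ 2 * (s + d ^ 2) ^ (q - 1) := by
    gcongr
    nlinarith [sq_nonneg d]
  nlinarith

theorem sq_rpow_eq (x r : ℝ) : (x ^ 2) ^ r = |x| ^ (2 * r) := by
  rw [← sq_abs, ← Real.rpow_natCast, ← Real.rpow_mul (abs_nonneg x)]
  norm_num

/-- The Bellman function for the opposite inequality. The constant 4q(2q-1) is the one in the
second-difference bound at r = 2q - 2, and r ≥ 1 is the condition q ≥ 3/2. -/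
theorem sq_rpow_sub_mul_rpow_midpoint {s : ℝ} (hs : 0 ≤ s) (x d : ℝ) {q : ℝ} (hq : 3 / 2 ≤ q) :
    (((x + d) ^ 2) ^ q - 4 * q * (2 * q - 1) * (s + d ^ 2) * ((x + d) ^ 2) ^ (q - 1)) +
      (((x - d) ^ 2) ^ q - 4 * q * (2 * q - 1) * (s + d ^ 2) * ((x - d) ^ 2) ^ (q - 1)) ≤
      2 * ((x ^ 2) ^ q - 4 * q * (2 * q - 1) * s * (x ^ 2) ^ (q - 1)) := by
  have h1 := abs_rpow_add_abs_rpow_sub_le x d (r := 2 * (q - 1)) (by linarith)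
  have h2 := abs_rpow_le_midpoint x d (r := 2 * (q - 1)) (by linarith)
  have e1 : 2 * (q - 1) + 2 = 2 * q := by ring
  have e2 : 2 * (q - 1) + 1 = 2 * q - 1 := by ring
  rw [e1, e2] at h1
  simp only [sq_rpow_eq]
  have h3 : 4 * q * (2 * q - 1) * s * (2 * |x| ^ (2 * (q - 1))) ≤
      4 * q * (2 * q - 1) * s * (|x + d| ^ (2 * (q - 1)) + |x - d| ^ (2 * (q - 1))) := by
    have : 0 ≤ 4 * q * (2 * q - 1) * s := by
      have : 0 ≤ 2 * q - 1 := by linarith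
      positivity
    gcongr
  linarith

/-! ### The square function of a sequence of sign-symmetric differences -/

section SquareFunction

variable {α : Type*} [MeasurableSpace α] {μ : Measure α}

/-- `d 0, d 1, …` are differences of a conditionally symmetric martingale: for `k ≥ 1` there is a
measure-preserving map fixing the functions `d i`, `i < k`, and changing the sign of `d k`. -/
def SignSymmetric (μ : Measure α) (d : ℕ → α → ℝ) : Prop :=
  ∀ k, 1 ≤ k → ∃ σ : α → α, MeasurePreserving σ μ μ ∧ (∀ i < k, ∀ x, d i (σ x) = d i x) ∧
    ∀ x, d k (σ x) = -d k x

theorem SignSymmetric.smul {d : ℕ → α → ℝ} (h : SignSymmetric μ d) (c : ℕ → ℝ) :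
    SignSymmetric μ (fun k x => c k * d k x) := by
  intro k hk
  obtain ⟨σ, h1, h2, h3⟩ := h k hk
  exact ⟨σ, h1, fun i hi x => by simp only [h2 i hi], fun x => by simp only [h3]; ring⟩

/-- Averaging an integrand with its composition by the map that flips `d k` turns the midpoint
condition on `U` into a decrease of ∫ U at each step. -/
theorem SignSymmetric.integral_bellman_nonpos {d : ℕ → α → ℝ} (h : SignSymmetric μ d)
    (U : ℝ → ℝ → ℝ) (hU0 : U 0 0 ≤ 0) (hU1 : ∀ x, U x (x ^ 2) ≤ 0)
    (hU : ∀ x s t, 0 ≤ s → U (x + t) (s + t ^ 2) + U (x - t) (s + t ^ 2) ≤ 2 * U x s)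
    (hUi : ∀ N, Integrable
      (fun x => U (∑ i ∈ Finset.range N, d i x) (∑ i ∈ Finset.range N, d i x ^ 2)) μ) (N : ℕ) :
    ∫ x, U (∑ i ∈ Finset.range N, d i x) (∑ i ∈ Finset.range N, d i x ^ 2) ∂μ ≤ 0 := by
  induction N with
  | zero => exact integral_nonpos fun x => by simpa using hU0
  | succ k ih =>
    rcases Nat.eq_zero_or_pos k with rfl | hk
    -- No symmetry is assumed of `d 0`, so the one-term sum rests on `U x (x ^ 2) ≤ 0`.
    · exact integral_nonpos fun x => by simpa using hU1 _
    obtain ⟨σ, hσ, hlt, hk'⟩ := h k hk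
    have hi := hUi (k + 1)
    set F := fun x => U (∑ i ∈ Finset.range (k + 1), d i x) (∑ i ∈ Finset.range (k + 1), d i x ^ 2)
      with hF
    have hi' : Integrable (fun x => F (σ x)) μ := hσ.integrable_comp_of_integrable hi
    have he : ∫ x, F (σ x) ∂μ = ∫ x, F x ∂μ := by
      conv_rhs => rw [← hσ.map_eq]
      rw [integral_map hσ.measurable.aemeasurable]
      rw [hσ.map_eq]
      exact hi.aestronglyMeasurable
    have hle : ∫ x, (F x + F (σ x)) ∂μ ≤ ∫ x, 2 * U (∑ i ∈ Finset.range k, d i x)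
        (∑ i ∈ Finset.range k, d i x ^ 2) ∂μ := by
      refine integral_mono (hi.add hi') ((hUi k).const_mul 2) fun x => ?_
      have e1 : ∑ i ∈ Finset.range k, d i (σ x) = ∑ i ∈ Finset.range k, d i x :=
        Finset.sum_congr rfl fun i hi => hlt i (Finset.mem_range.1 hi) x
      have e2 : ∑ i ∈ Finset.range k, d i (σ x) ^ 2 = ∑ i ∈ Finset.range k, d i x ^ 2 :=
        Finset.sum_congr rfl fun i hi => by rw [hlt i (Finset.mem_range.1 hi) x]
      simp only [hF, Finset.sum_range_succ, e1, e2, hk', neg_sq, ← sub_eq_add_neg]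
      exact hU _ _ _ (Finset.sum_nonneg fun i _ => sq_nonneg _)
    rw [integral_add hi hi', he, integral_const_mul] at hle
    linarith

theorem integrable_abs_rpow_of_memLp {f : α → ℝ} {P : ℝ} (hP : 0 < P)
    (hf : MemLp f (ENNReal.ofReal P) μ) : Integrable (fun x => |f x| ^ P) μ := by
  have := hf.integrable_norm_rpow (by simpa using hP) ENNReal.ofReal_ne_top
  simpa [ENNReal.toReal_ofReal hP.le] using this

theorem mul_rpow_sub_one_le {u v r : ℝ} (hu : 0 ≤ u) (hv : 0 ≤ v) (hr : 1 ≤ r) :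
    u * v ^ (r - 1) ≤ u ^ r + v ^ r := by
  have key : ∀ {w : ℝ}, 0 ≤ w → w * w ^ (r - 1) = w ^ r := by
    intro w hw
    conv_lhs => rw [mul_comm, ← Real.rpow_add_one' hw (by linarith)]
    ring_nf
  have hur : 0 ≤ u ^ r := Real.rpow_nonneg hu r
  have hvr : 0 ≤ v ^ r := Real.rpow_nonneg hv r
  rcases le_total u v with h | h
  · calc u * v ^ (r - 1) ≤ v * v ^ (r - 1) := by gcongr
      _ ≤ _ := by rw [key hv]; linarith
  · calc u * v ^ (r - 1) ≤ u * u ^ (r - 1) := by gcongr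
      _ ≤ _ := by rw [key hu]; linarith

theorem integrable_mul_rpow_sub_one {u v : α → ℝ} {q : ℝ} (hq : 1 ≤ q) (hu : ∀ x, 0 ≤ u x)
    (hv : ∀ x, 0 ≤ v x) (hum : AEStronglyMeasurable u μ) (hvm : AEStronglyMeasurable v μ)
    (hui : Integrable (fun x => u x ^ q) μ) (hvi : Integrable (fun x => v x ^ q) μ) :
    Integrable (fun x => u x * v x ^ (q - 1)) μ := by
  refine (hui.add hvi).mono'
    (hum.mul (hvm.aemeasurable.pow_const (q - 1)).aestronglyMeasurable) ?_
  refine Filter.Eventually.of_forall fun x => ?_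
  rw [Real.norm_of_nonneg (mul_nonneg (hu x) (Real.rpow_nonneg (hv x) _))]
  exact mul_rpow_sub_one_le (hu x) (hv x) hq

/-- Constant in the square function inequality. -/
def squareConst (q : ℝ) : ℝ :=
  2 * (4 * q * (2 * q - 1)) * (2 * (4 * q * (2 * q - 1))) ^ (q - 1) + 2 * q * (2 * q) ^ (q - 1)

theorem squareConst_pos {q : ℝ} (hq : 3 / 2 ≤ q) : 0 < squareConst q := by
  unfold squareConst
  have : 0 < 2 * q - 1 := by linarith
  positivity

theorem integrable_sq_sum_rpow {d : ℕ → α → ℝ} {q : ℝ} (hq : 3 / 2 ≤ q)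
    (hd : ∀ k, MemLp (d k) (ENNReal.ofReal (2 * q)) μ) (N : ℕ) :
    Integrable (fun x => ((∑ i ∈ Finset.range N, d i x) ^ 2) ^ q) μ := by
  have h1 : MemLp (fun x => ∑ i ∈ Finset.range N, d i x) (ENNReal.ofReal (2 * q)) μ :=
    memLp_finsetSum _ fun i _ => hd i
  simpa only [sq_rpow_eq] using integrable_abs_rpow_of_memLp (by linarith) h1

theorem integrable_sum_sq_rpow {d : ℕ → α → ℝ} {q : ℝ} (hq : 3 / 2 ≤ q)
    (hd : ∀ k, MemLp (d k) (ENNReal.ofReal (2 * q)) μ) (N : ℕ) :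
    Integrable (fun x => (∑ i ∈ Finset.range N, d i x ^ 2) ^ q) μ := by
  have h1 : Integrable (fun x => ((∑ i ∈ Finset.range N, |d i x|) ^ 2) ^ q) μ :=
    integrable_sq_sum_rpow (d := fun i x => |d i x|) hq (fun k => (hd k).abs) N
  refine h1.mono' ?_ (Filter.Eventually.of_forall fun x => ?_)
  · refine AEMeasurable.aestronglyMeasurable (AEMeasurable.pow_const ?_ q)
    exact Finset.aemeasurable_fun_sum _ fun i _ =>
      (hd i).aestronglyMeasurable.aemeasurable.pow_const 2
  · have h0 : 0 ≤ ∑ i ∈ Finset.range N, d i x ^ 2 := Finset.sum_nonneg fun i _ => sq_nonneg _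
    rw [Real.norm_of_nonneg (Real.rpow_nonneg h0 _)]
    refine Real.rpow_le_rpow h0 ?_ (by linarith)
    simpa using Finset.sum_sq_le_sq_sum_of_nonneg (s := Finset.range N)
      (f := fun i => |d i x|) fun i _ => abs_nonneg _

theorem SignSymmetric.square_function {d : ℕ → α → ℝ} (h : SignSymmetric μ d) {q : ℝ}
    (hq : 3 / 2 ≤ q) (hd : ∀ k, MemLp (d k) (ENNReal.ofReal (2 * q)) μ) (N : ℕ) :
    ∫ x, (∑ i ∈ Finset.range N, d i x ^ 2) ^ q ∂μ ≤
        squareConst q * ∫ x, ((∑ i ∈ Finset.range N, d i x) ^ 2) ^ q ∂μ ∧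
      ∫ x, ((∑ i ∈ Finset.range N, d i x) ^ 2) ^ q ∂μ ≤
        squareConst q * ∫ x, (∑ i ∈ Finset.range N, d i x ^ 2) ^ q ∂μ := by
  have hq1 : 1 ≤ q := by linarith
  have hq2 : 0 < 2 * q - 1 := by linarith
  set A := 4 * q * (2 * q - 1) with hA
  have hA0 : 0 ≤ A := by positivity
  have hA1 : 1 ≤ A := by nlinarith
  have hsn : ∀ N x, 0 ≤ ∑ i ∈ Finset.range N, d i x ^ 2 := fun N x =>
    Finset.sum_nonneg fun i _ => sq_nonneg _
  have hsm : ∀ N, AEStronglyMeasurable (fun x => ∑ i ∈ Finset.range N, d i x ^ 2) μ := fun N =>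
    (Finset.aemeasurable_fun_sum _ fun i _ =>
      (hd i).aestronglyMeasurable.aemeasurable.pow_const 2).aestronglyMeasurable
  have hfm : ∀ N, AEStronglyMeasurable (fun x => (∑ i ∈ Finset.range N, d i x) ^ 2) μ := fun N =>
    ((Finset.aemeasurable_fun_sum _ fun i _ =>
      (hd i).aestronglyMeasurable.aemeasurable).pow_const 2).aestronglyMeasurable
  have hfi := integrable_sq_sum_rpow hq hd
  have hsi := integrable_sum_sq_rpow hq hd
  have hfs := fun N => integrable_mul_rpow_sub_one hq1 (fun x => sq_nonneg _) (hsn N) (hfm N)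
    (hsm N) (hfi N) (hsi N)
  have hsf := fun N => integrable_mul_rpow_sub_one hq1 (hsn N) (fun x => sq_nonneg _) (hsm N)
    (hfm N) (hsi N) (hfi N)
  have key : ∀ x : ℝ, x ^ 2 * (x ^ 2) ^ (q - 1) = (x ^ 2) ^ q := by
    intro x
    conv_lhs => rw [mul_comm, ← Real.rpow_add_one' (sq_nonneg x) (by linarith)]
    ring_nf
  have hz : (0 : ℝ) ^ q = 0 := Real.zero_rpow (by linarith)
  have fnn : 0 ≤ ∫ x, ((∑ i ∈ Finset.range N, d i x) ^ 2) ^ q ∂μ :=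
    integral_nonneg fun x => Real.rpow_nonneg (sq_nonneg _) _
  have snn : 0 ≤ ∫ x, (∑ i ∈ Finset.range N, d i x ^ 2) ^ q ∂μ :=
    integral_nonneg fun x => Real.rpow_nonneg (hsn N x) _
  constructor
  · have h1 := h.integral_bellman_nonpos (fun x s => s ^ q - q * (x ^ 2 * s ^ (q - 1))) (by simp [hz])
      (fun x => by
        have : 0 ≤ (x ^ 2) ^ q := by positivity
        simp only [key]; nlinarith)
      (fun x s t hs => by
        have := rpow_sub_mul_rpow_midpoint hs x t hq1
        simp only [← mul_assoc]; exact this)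
      (fun N => (hsi N).sub ((hfs N).const_mul q)) N
    rw [integral_sub (hsi N) ((hfs N).const_mul q), integral_const_mul] at h1
    -- The mixed term is split by `mul_mul_rpow_le`; half of the square function integral goes back
    -- to the left side, which doubles the constant.
    have h2 : ∫ x, q * ((∑ i ∈ Finset.range N, d i x) ^ 2 *
        (∑ i ∈ Finset.range N, d i x ^ 2) ^ (q - 1)) ∂μ ≤
        ∫ x, ((∑ i ∈ Finset.range N, d i x ^ 2) ^ q / 2 + q * (2 * q) ^ (q - 1) *
          ((∑ i ∈ Finset.range N, d i x) ^ 2) ^ q) ∂μ := by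
      refine integral_mono ((hfs N).const_mul q)
        (((hsi N).div_const 2).add ((hfi N).const_mul _)) fun x => ?_
      have := mul_mul_rpow_le (sq_nonneg (∑ i ∈ Finset.range N, d i x)) (hsn N x)
        (by linarith : 0 ≤ q) hq1
      simpa only [mul_assoc] using this
    rw [integral_add ((hsi N).div_const 2) ((hfi N).const_mul _), integral_div,
      integral_const_mul, integral_const_mul] at h2
    have h3 : 0 ≤ 2 * A * (2 * A) ^ (q - 1) *
        ∫ x, ((∑ i ∈ Finset.range N, d i x) ^ 2) ^ q ∂μ := by positivity
    rw [squareConst, ← hA]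
    linarith
  · have h1 := h.integral_bellman_nonpos (fun x s => (x ^ 2) ^ q - A * (s * (x ^ 2) ^ (q - 1)))
      (by simp [hz])
      (fun x => by
        have : 0 ≤ (x ^ 2) ^ q := by positivity
        simp only [key]; nlinarith)
      (fun x s t hs => by
        have := sq_rpow_sub_mul_rpow_midpoint hs x t hq
        simp only [← mul_assoc]; exact this)
      (fun N => (hfi N).sub ((hsf N).const_mul A)) N
    rw [integral_sub (hfi N) ((hsf N).const_mul A), integral_const_mul] at h1
    have h2 : ∫ x, A * ((∑ i ∈ Finset.range N, d i x ^ 2) *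
        ((∑ i ∈ Finset.range N, d i x) ^ 2) ^ (q - 1)) ∂μ ≤
        ∫ x, (((∑ i ∈ Finset.range N, d i x) ^ 2) ^ q / 2 + A * (2 * A) ^ (q - 1) *
          (∑ i ∈ Finset.range N, d i x ^ 2) ^ q) ∂μ := by
      refine integral_mono ((hsf N).const_mul A)
        (((hfi N).div_const 2).add ((hsi N).const_mul _)) fun x => ?_
      have := mul_mul_rpow_le (hsn N x) (sq_nonneg (∑ i ∈ Finset.range N, d i x)) hA0 hq1
      simpa only [mul_assoc] using this
    rw [integral_add ((hfi N).div_const 2) ((hsi N).const_mul _), integral_div,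
      integral_const_mul, integral_const_mul] at h2
    have h3 : 0 ≤ 2 * q * (2 * q) ^ (q - 1) *
        ∫ x, (∑ i ∈ Finset.range N, d i x ^ 2) ^ q ∂μ := by positivity
    rw [squareConst, ← hA]
    linarith

end SquareFunction

/-! ### Exchanging pieces of the line -/

/-- The map exchanging `E` and `E + t` by translation, and fixing all other points. -/
def swapMap (E : Set ℝ) (t : ℝ) : ℝ → ℝ := by
  classical exact fun x => if x ∈ E then x + t else if x - t ∈ E then x - t else x

theorem measurable_swapMap {E : Set ℝ} (hE : MeasurableSet E) (t : ℝ) :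
    Measurable (swapMap E t) := by
  classical
  unfold swapMap
  refine Measurable.ite hE (by fun_prop) (Measurable.ite ?_ (by fun_prop) measurable_id)
  exact (measurable_id.sub_const t) hE

/-- The preimage is cut along `E`, `E + t` and the rest; on each piece the map is a translation or
the identity. -/
theorem measurePreserving_swapMap {E : Set ℝ} (hE : MeasurableSet E) {t : ℝ}
    (hdisj : ∀ x ∈ E, x + t ∉ E) : MeasurePreserving (swapMap E t) volume volume := by
  refine ⟨measurable_swapMap hE t, Measure.ext fun A hA => ?_⟩
  rw [Measure.map_apply (measurable_swapMap hE t) hA]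
  set T : Set ℝ := (fun x => x - t) ⁻¹' E with hT
  have hTm : MeasurableSet T := (measurable_id.sub_const t) hE
  have hd : ∀ x ∈ T, x ∉ E := fun x hx hx' => by
    have := hdisj (x - t) hx
    simp [hx'] at this
  have h1 : swapMap E t ⁻¹' A ∩ E = (fun x => x + t) ⁻¹' (A ∩ T) := by
    ext x
    by_cases hx : x ∈ E <;> simp [swapMap, hT, hx]
  have h2 : (swapMap E t ⁻¹' A \ E) ∩ T = (fun x => x + -t) ⁻¹' (A ∩ E) := by
    ext x
    by_cases hx : x - t ∈ E
    · have hx' : x ∉ E := hd x hx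
      simp [swapMap, hT, hx, hx', ← sub_eq_add_neg]
    · simp [hT, hx, ← sub_eq_add_neg]
  have h3 : (swapMap E t ⁻¹' A \ E) \ T = (A \ E) \ T := by
    ext x
    by_cases hx : x ∈ E
    · simp [hx]
    by_cases hx' : x - t ∈ E
    · simp [hT, hx']
    · simp [swapMap, hT, hx, hx']
  have h4 : (A \ E) ∩ T = A ∩ T := by
    ext x
    constructor
    · rintro ⟨⟨h, -⟩, h'⟩; exact ⟨h, h'⟩
    · rintro ⟨h, h'⟩; exact ⟨⟨h, hd x h'⟩, h'⟩
  rw [← measure_inter_add_sdiff (swapMap E t ⁻¹' A) hE,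
    ← measure_inter_add_sdiff (swapMap E t ⁻¹' A \ E) hTm, h1, h2, h3,
    measure_preimage_add_right, measure_preimage_add_right,
    ← measure_inter_add_sdiff A hE, ← measure_inter_add_sdiff (A \ E) hTm, h4, ← add_assoc,
    ← add_assoc, add_comm (volume (A ∩ T))]

/-! ### Dyadic indices -/

/-- The index `m` of the dyadic interval `[m / 2 ^ k, (m + 1) / 2 ^ k)` containing `x`. -/
def dyadicIndex (k : ℕ) (x : ℝ) : ℤ := ⌊2 ^ k * x⌋

theorem measurable_dyadicIndex (k : ℕ) : Measurable (dyadicIndex k) := by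
  unfold dyadicIndex; fun_prop

theorem dyadicIndex_eq_iff {k : ℕ} {x : ℝ} {m : ℤ} :
    dyadicIndex k x = m ↔ (m : ℝ) / 2 ^ k ≤ x ∧ x < (m + 1) / 2 ^ k := by
  rw [dyadicIndex, Int.floor_eq_iff, div_le_iff₀ (by positivity), lt_div_iff₀ (by positivity),
    mul_comm]

theorem dyadicIndex_eq_succ_div (k : ℕ) (x : ℝ) : dyadicIndex k x = dyadicIndex (k + 1) x / 2 := by
  have e : (2 : ℝ) ^ (k + 1) * x = 2 * (2 ^ k * x) := by ring
  unfold dyadicIndex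
  rw [e, Int.floor_eq_iff]
  set y := (2 : ℝ) ^ k * x
  have h1 := Int.floor_le (2 * y)
  have h2 := Int.lt_floor_add_one (2 * y)
  set z := ⌊2 * y⌋
  have h3 : 2 * (z / 2) ≤ z := by omega
  have h4 : z + 1 ≤ 2 * (z / 2) + 2 := by omega
  have h3' : (2 : ℝ) * ((z / 2 : ℤ) : ℝ) ≤ z := by exact_mod_cast h3
  have h4' : (z : ℝ) + 1 ≤ 2 * ((z / 2 : ℤ) : ℝ) + 2 := by exact_mod_cast h4
  constructor <;> linarith

theorem dyadicIndex_eq_of_le {k l : ℕ} (hkl : k ≤ l) {x y : ℝ}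
    (h : dyadicIndex l x = dyadicIndex l y) : dyadicIndex k x = dyadicIndex k y := by
  induction l, hkl using Nat.le_induction with
  | base => exact h
  | succ l _ ih => exact ih (by rw [dyadicIndex_eq_succ_div, dyadicIndex_eq_succ_div l y, h])

theorem dyadicIndex_add (k : ℕ) (x : ℝ) : dyadicIndex k (x + 1 / 2 ^ k) = dyadicIndex k x + 1 := by
  unfold dyadicIndex
  rw [mul_add, mul_one_div_cancel (by positivity), Int.floor_add_one]

theorem dyadicIndex_sub (k : ℕ) (x : ℝ) : dyadicIndex k (x - 1 / 2 ^ k) = dyadicIndex k x - 1 := by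
  have := dyadicIndex_add k (x - 1 / 2 ^ k)
  rw [sub_add_cancel] at this
  omega

/-- Exchange of the dyadic intervals of index `a` and `a + 1` at level `k`, for all `a ∈ S`. -/
def dyadicSwap (k : ℕ) (S : Set ℤ) : ℝ → ℝ := swapMap (dyadicIndex k ⁻¹' S) (1 / 2 ^ k)

theorem measurePreserving_dyadicSwap (k : ℕ) {S : Set ℤ} (hS : ∀ a ∈ S, Even a) :
    MeasurePreserving (dyadicSwap k S) volume volume := by
  refine measurePreserving_swapMap (measurable_dyadicIndex k (MeasurableSet.of_discrete)) ?_
  intro x hx hx'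
  rw [mem_preimage] at hx hx'
  rw [dyadicIndex_add] at hx'
  have h1 := hS _ hx
  have h2 := hS _ hx'
  rw [Int.even_iff] at h1 h2
  omega

open Classical in
theorem dyadicIndex_dyadicSwap (k : ℕ) (S : Set ℤ) (x : ℝ) :
    dyadicIndex k (dyadicSwap k S x) = if dyadicIndex k x ∈ S then dyadicIndex k x + 1
      else if dyadicIndex k x - 1 ∈ S then dyadicIndex k x - 1 else dyadicIndex k x := by
  unfold dyadicSwap swapMap
  simp only [mem_preimage, dyadicIndex_sub]
  split_ifs
  · exact dyadicIndex_add k x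
  · exact dyadicIndex_sub k x
  · rfl

/-- For even a, the intervals a and a + 1 are the two halves of one parent, so coarser levels do not
see the exchange. -/
theorem dyadicIndex_dyadicSwap_of_lt {k l : ℕ} (hkl : k < l) {S : Set ℤ} (hS : ∀ a ∈ S, Even a)
    (x : ℝ) : dyadicIndex k (dyadicSwap l S x) = dyadicIndex k x := by
  classical
  obtain ⟨l, rfl⟩ : ∃ l', l = l' + 1 := ⟨l - 1, by omega⟩
  refine dyadicIndex_eq_of_le (Nat.lt_succ_iff.1 hkl) ?_
  rw [dyadicIndex_eq_succ_div, dyadicIndex_eq_succ_div l x, dyadicIndex_dyadicSwap]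
  split_ifs with h1 h2
  · have := hS _ h1
    rw [Int.even_iff] at this
    omega
  · have := hS _ h2
    rw [Int.even_iff] at this
    omega
  · rfl

/-! ### Haar functions on the half-open unit interval -/

/-- The Haar functions, restricted to `[0, 1)`. -/
def haarIco (n : ℕ) : ℝ → ℝ := (Ico (0 : ℝ) 1).indicator (haarFun n)

theorem haarIco_zero (x : ℝ) : haarIco 0 x = if dyadicIndex 0 x = 0 then 1 else 0 := by
  have : dyadicIndex 0 x = 0 ↔ x ∈ Ico (0 : ℝ) 1 := by
    rw [dyadicIndex_eq_iff]; simp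
  simp only [this, haarIco, haarFun, if_true, indicator]
  split_ifs with h h'
  · rfl
  · exact absurd (Ico_subset_Icc_self h) h'
  · rfl

theorem dyadicHaar_eq (k m : ℕ) (x : ℝ) :
    dyadicHaar k m x = if dyadicIndex (k + 1) x = 2 * m then 1
      else if dyadicIndex (k + 1) x = 2 * m + 1 then -1 else 0 := by
  have e1 : dyadicIndex (k + 1) x = 2 * m ↔
      x ∈ Ico ((m : ℝ) / 2 ^ k) (((m : ℝ) + 1 / 2) / 2 ^ k) := by
    rw [dyadicIndex_eq_iff, mem_Ico]
    push_cast
    rw [show (2 * (m : ℝ)) / 2 ^ (k + 1) = m / 2 ^ k by field_simp; ring,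
      show (2 * (m : ℝ) + 1) / 2 ^ (k + 1) = (m + 1 / 2) / 2 ^ k by field_simp; ring]
  have e2 : dyadicIndex (k + 1) x = 2 * m + 1 ↔
      x ∈ Ico (((m : ℝ) + 1 / 2) / 2 ^ k) (((m : ℝ) + 1) / 2 ^ k) := by
    rw [dyadicIndex_eq_iff, mem_Ico]
    push_cast
    rw [show (2 * (m : ℝ) + 1 + 1) / 2 ^ (k + 1) = (m + 1) / 2 ^ k by field_simp; ring,
      show (2 * (m : ℝ) + 1) / 2 ^ (k + 1) = (m + 1 / 2) / 2 ^ k by field_simp; ring]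
  simp only [dyadicHaar, Pi.sub_apply, indicator, ← e1, ← e2, Pi.one_apply]
  split_ifs <;> first | omega | simp

theorem dyadicIndex_eq_imp_mem_Ico {k : ℕ} {x : ℝ} {m : ℤ} (h : dyadicIndex k x = m)
    (h0 : 0 ≤ m) (h1 : m < 2 ^ k) : x ∈ Ico (0 : ℝ) 1 := by
  rw [dyadicIndex_eq_iff] at h
  have hm0 : (0 : ℝ) ≤ m := by exact_mod_cast h0
  have hm1 : (m : ℝ) + 1 ≤ 2 ^ k := by exact_mod_cast h1
  refine ⟨le_trans (by positivity) h.1, lt_of_lt_of_le h.2 ?_⟩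
  rw [div_le_one (by positivity)]
  exact hm1

/-- The position of the `n`-th Haar function within its level. -/
abbrev haarPos (n : ℕ) : ℕ := n - 2 ^ Nat.log 2 n

theorem haarPos_lt {n : ℕ} (hn : n ≠ 0) : haarPos n < 2 ^ Nat.log 2 n := by
  have := Nat.lt_pow_succ_log_self (b := 2) (by norm_num) n
  have h2 := Nat.pow_log_le_self 2 hn
  rw [pow_succ] at this
  unfold haarPos
  omega

theorem haarIco_of_ne_zero {n : ℕ} (hn : n ≠ 0) (x : ℝ) :
    haarIco n x = if dyadicIndex (Nat.log 2 n + 1) x = 2 * haarPos n then 1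
      else if dyadicIndex (Nat.log 2 n + 1) x = 2 * haarPos n + 1 then -1 else 0 := by
  have hlt : (haarPos n : ℤ) < 2 ^ Nat.log 2 n := by exact_mod_cast haarPos_lt hn
  have hpow : (2 : ℤ) ^ (Nat.log 2 n + 1) = 2 * 2 ^ Nat.log 2 n := by ring
  rw [← dyadicHaar_eq, haarIco, haarFun, if_neg hn]
  by_cases hx : x ∈ Ico (0 : ℝ) 1
  · rw [indicator_of_mem hx]
  · rw [indicator_of_notMem hx, dyadicHaar_eq, if_neg, if_neg]
    · exact fun h => hx (dyadicIndex_eq_imp_mem_Ico h (by omega) (by omega))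
    · exact fun h => hx (dyadicIndex_eq_imp_mem_Ico h (by omega) (by omega))

theorem haarIco_congr {n k : ℕ} (hk : Nat.log 2 n + 1 ≤ k) {x y : ℝ}
    (h : dyadicIndex k x = dyadicIndex k y) : haarIco n x = haarIco n y := by
  rcases eq_or_ne n 0 with rfl | hn
  · rw [haarIco_zero, haarIco_zero, dyadicIndex_eq_of_le (Nat.zero_le k) h]
  · rw [haarIco_of_ne_zero hn, haarIco_of_ne_zero hn, dyadicIndex_eq_of_le hk h]

/-- Exchanging the two halves of the support of the n-th function negates it. Others of its level
have disjoint support, and coarser ones are constant on that support. -/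
theorem signSymmetric_haarIco : SignSymmetric volume haarIco := by
  classical
  intro n hn
  have hn0 : n ≠ 0 := by omega
  have hS : ∀ a ∈ ({2 * (haarPos n : ℤ)} : Set ℤ), Even a := by
    rintro a rfl; exact even_two_mul _
  refine ⟨dyadicSwap (Nat.log 2 n + 1) {2 * (haarPos n : ℤ)}, measurePreserving_dyadicSwap _ hS,
    fun i hi x => ?_, fun x => ?_⟩
  · have hlog : Nat.log 2 i ≤ Nat.log 2 n := Nat.log_mono_right hi.le
    rcases eq_or_ne i 0 with rfl | hi0
    · rw [haarIco_zero, haarIco_zero, dyadicIndex_dyadicSwap_of_lt (Nat.succ_pos _) hS]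
    rcases hlog.eq_or_lt with hlog | hlog
    · have hne : haarPos i ≠ haarPos n := by
        have h1 := Nat.pow_log_le_self 2 hi0
        have h2 := Nat.pow_log_le_self 2 hn0
        unfold haarPos
        rw [hlog] at h1 ⊢
        omega
      rw [haarIco_of_ne_zero hi0, haarIco_of_ne_zero hi0, hlog, dyadicIndex_dyadicSwap]
      simp only [mem_singleton_iff]
      split_ifs <;> first | rfl | omega
    · exact haarIco_congr le_rfl (dyadicIndex_dyadicSwap_of_lt (by omega) hS x)
  · rw [haarIco_of_ne_zero hn0, haarIco_of_ne_zero hn0, dyadicIndex_dyadicSwap]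
    simp only [mem_singleton_iff]
    split_ifs <;> first | omega | simp

/-- The Rademacher function of level `k`. -/
def rademacher (k : ℕ) (x : ℝ) : ℝ := if Even (dyadicIndex k x) then 1 else -1

theorem rademacher_sq (k : ℕ) (x : ℝ) : rademacher k x ^ 2 = 1 := by
  unfold rademacher; split_ifs <;> norm_num

theorem measurable_rademacher (k : ℕ) : Measurable (rademacher k) :=
  Measurable.ite (measurable_dyadicIndex k (MeasurableSet.of_discrete (s := {a | Even a})))
    measurable_const measurable_const

/-- Level `j + 2` is finer than the level, at most `j + 1`, that determines `haarIco (φ j)`.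
Exchanging all sibling pairs of level `n + 2` flips only the last Rademacher factor, so φ may repeat
values. -/
theorem signSymmetric_haarIco_mul_rademacher {φ : ℕ → ℕ} (hφ : ∀ j, φ j ≤ j) :
    SignSymmetric volume (fun j x => haarIco (φ j) x * rademacher (j + 2) x) := by
  classical
  intro n _
  have hS : ∀ a ∈ {a : ℤ | Even a}, Even a := fun a ha => ha
  have hlog : ∀ j, Nat.log 2 (φ j) ≤ j := fun j => (Nat.log_le_self 2 _).trans (hφ j)
  refine ⟨dyadicSwap (n + 2) {a | Even a}, measurePreserving_dyadicSwap _ hS,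
    fun i hi x => ?_, fun x => ?_⟩
  · have h1 : haarIco (φ i) (dyadicSwap (n + 2) {a | Even a} x) = haarIco (φ i) x :=
      haarIco_congr (by have := hlog i; omega)
        (dyadicIndex_dyadicSwap_of_lt (k := i + 1) (by omega) hS x)
    simp only [h1, rademacher]
    rw [dyadicIndex_dyadicSwap_of_lt (by omega) hS x]
  · have h1 : haarIco (φ n) (dyadicSwap (n + 2) {a | Even a} x) = haarIco (φ n) x :=
      haarIco_congr (by have := hlog n; omega)
        (dyadicIndex_dyadicSwap_of_lt (k := n + 1) (by omega) hS x)
    simp only [h1, rademacher]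
    rw [dyadicIndex_dyadicSwap]
    simp only [mem_ofPred_eq, Int.even_iff]
    split_ifs <;> first | omega | simp

/-! ### Measurability and integrability of the Haar functions -/

theorem measurable_haarFun (n : ℕ) : Measurable (haarFun n) := by
  have key : ∀ s : Set ℝ, MeasurableSet s → Measurable (s.indicator (1 : ℝ → ℝ)) :=
    fun s hs => measurable_one.indicator hs
  unfold haarFun
  split_ifs
  · exact key _ measurableSet_Icc
  · exact (key _ measurableSet_Ico).sub (key _ measurableSet_Ico)

theorem measurable_haarIco (n : ℕ) : Measurable (haarIco n) :=
  (measurable_haarFun n).indicator measurableSet_Ico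

theorem abs_haarIco_le_one (n : ℕ) (x : ℝ) : |haarIco n x| ≤ 1 := by
  rcases eq_or_ne n 0 with rfl | hn
  · rw [haarIco_zero]; split_ifs <;> simp
  · rw [haarIco_of_ne_zero hn]; split_ifs <;> simp

theorem haarIco_of_notMem (n : ℕ) {x : ℝ} (hx : x ∉ Ico (0 : ℝ) 1) : haarIco n x = 0 :=
  indicator_of_notMem hx _

theorem memLp_of_bounded_support {u : ℝ → ℝ} (hu : Measurable u) {C : ℝ} (hC : ∀ x, |u x| ≤ C)
    (h0 : ∀ x, x ∉ Ico (0 : ℝ) 1 → u x = 0) (p : ℝ≥0∞) : MemLp u p volume := by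
  have h : (Ico (0 : ℝ) 1).indicator u = u := by
    ext x
    by_cases hx : x ∈ Ico (0 : ℝ) 1
    · rw [indicator_of_mem hx]
    · rw [indicator_of_notMem hx, h0 x hx]
  rw [← h, memLp_indicator_iff_restrict measurableSet_Ico]
  exact MemLp.of_bound hu.aestronglyMeasurable C (Filter.Eventually.of_forall hC)

theorem memLp_haarIco (p : ℝ≥0∞) (n : ℕ) : MemLp (haarIco n) p volume :=
  memLp_of_bounded_support (measurable_haarIco n) (abs_haarIco_le_one n)
    (fun _ hx => haarIco_of_notMem n hx) p

/-! ### Unconditional basic families and equivalent sequences -/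

section Banach

variable {ι E F : Type*} [NormedAddCommGroup E] [NormedSpace ℝ E]
  [NormedAddCommGroup F] [NormedSpace ℝ F]

theorem mem_closedSpan (x : ι → E) (i : ι) : x i ∈ closedSpan x :=
  Submodule.le_topologicalClosure _ (Submodule.subset_span (mem_range_self i))

theorem linearCombination_eq_sum (x : ι → E) {a : ι →₀ ℝ} {A : Finset ι} (hA : a.support ⊆ A) :
    Finsupp.linearCombination ℝ x a = ∑ i ∈ A, a i • x i := by
  rw [Finsupp.linearCombination_apply]
  exact Finsupp.sum_of_support_subset a hA (fun j c => c • x j) (by simp)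

theorem exists_linearCombination_eq {x : ι → E} {v : E} (hv : v ∈ Submodule.span ℝ (range x)) :
    ∃ a, Finsupp.linearCombination ℝ x a = v := by
  rw [← Finsupp.range_linearCombination] at hv; exact hv

theorem linearIndependent_of_norm_sum_le {x : ι → E} (hx : ∀ i, x i ≠ 0) {C : ℝ}
    (h : ∀ (A B : Finset ι) (a : ι → ℝ), A ⊆ B →
      ‖∑ i ∈ A, a i • x i‖ ≤ C * ‖∑ i ∈ B, a i • x i‖) : LinearIndependent ℝ x := by
  rw [linearIndependent_iff']
  intro s a hs i hi
  have := h {i} s a (by simpa using hi)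
  rw [hs, norm_zero, mul_zero, Finset.sum_singleton, norm_le_zero_iff, smul_eq_zero] at this
  exact this.resolve_right (hx i)

/-- The hypothesis for a singleton bounds the i-th coordinate on the span; Hahn–Banach extends it to
`E`. -/
theorem exists_biorthogonal {x : ι → E} (hx : ∀ i, x i ≠ 0) {C : ℝ}
    (h : ∀ (A B : Finset ι) (a : ι → ℝ), A ⊆ B →
      ‖∑ i ∈ A, a i • x i‖ ≤ C * ‖∑ i ∈ B, a i • x i‖) (i : ι) :
    ∃ g : StrongDual ℝ E, ∀ a : ι →₀ ℝ, g (Finsupp.linearCombination ℝ x a) = a i := by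
  have hli := linearIndependent_of_norm_sum_le hx h
  let φ : Submodule.span ℝ (range x) →ₗ[ℝ] ℝ := Finsupp.lapply i ∘ₗ hli.repr
  have hφ : ∀ a : ι →₀ ℝ, φ ⟨Finsupp.linearCombination ℝ x a,
      by rw [← Finsupp.range_linearCombination]; exact ⟨a, rfl⟩⟩ = a i := by
    intro a
    simp only [φ, LinearMap.comp_apply, Finsupp.lapply_apply]
    rw [hli.repr_eq rfl]
  have hb : ∀ v, ‖φ v‖ ≤ C / ‖x i‖ * ‖v‖ := by
    rintro ⟨v, hv⟩
    obtain ⟨a, rfl⟩  := exists_linearCombination_eq hv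
    rw [hφ a, div_mul_eq_mul_div, le_div_iff₀ (norm_pos_iff.2 (hx i)), ← norm_smul]
    classical
    have := h {i} (insert i a.support) a (by simp)
    rw [Finset.sum_singleton] at this
    rwa [← linearCombination_eq_sum x (Finset.subset_insert i a.support)] at this
  obtain ⟨g, hg, -⟩ := exists_extension_norm_eq _ (φ.mkContinuous _ hb)
  refine ⟨g, fun a => ?_⟩
  rw [← hφ a]
  exact hg ⟨_, _⟩

/-- Uniformly bounded finite coordinate projections converge on the closed span because they are
eventually the identity on each vector of the dense span. -/
theorem isUnconditionalBasic_of_norm_sum_le {x : ι → E} (hx : ∀ i, x i ≠ 0) {C : ℝ}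
    (h : ∀ (A B : Finset ι) (a : ι → ℝ), A ⊆ B →
      ‖∑ i ∈ A, a i • x i‖ ≤ C * ‖∑ i ∈ B, a i • x i‖) : IsUnconditionalBasic x := by
  classical
  choose g hg using exists_biorthogonal hx h
  have hgx : ∀ i j, g i (x j) = (Pi.single j (1 : ℝ) : ι → ℝ) i := by
    intro i j
    have := hg i (Finsupp.single j 1)
    rw [Finsupp.linearCombination_single, one_smul] at this
    rw [this, Finsupp.single_apply, Pi.single_apply]
    simp [eq_comm]
  have hproj : ∀ (A : Finset ι) (v : E), v ∈ closedSpan x →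
      ‖∑ i ∈ A, g i v • x i‖ ≤ C * ‖v‖ := by
    intro A v hv
    have hcl : IsClosed {v : E | ‖∑ i ∈ A, g i v • x i‖ ≤ C * ‖v‖} :=
      isClosed_le (by fun_prop) (by fun_prop)
    refine closure_minimal ?_ hcl hv
    intro v hv
    obtain ⟨a, rfl⟩  := exists_linearCombination_eq hv
    simp only [mem_ofPred_eq, hg]
    refine (h A (A ∪ a.support) a Finset.subset_union_left).trans_eq ?_
    rw [linearCombination_eq_sum x Finset.subset_union_right]
  refine ⟨{ basis := fun i => ⟨x i, mem_closedSpan x i⟩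
            coord := fun i => (g i).comp (closedSpan x).subtypeL
            ortho := fun i j => by simpa using hgx i j
            expansion := ?_ }, fun i => rfl⟩
  rintro ⟨v, hv⟩
  rw [HasSum, SummationFilter.unconditional_filter, Metric.tendsto_atTop]
  intro ε hε
  have hC : 0 ≤ |C| := abs_nonneg C
  obtain ⟨w, hw, hvw⟩ := Metric.mem_closure_iff.1 hv (ε / (|C| + 2)) (by positivity)
  obtain ⟨a, rfl⟩  := exists_linearCombination_eq hw
  refine ⟨a.support, fun A hA => ?_⟩
  rw [Subtype.dist_eq]
  have e1 : ((∑ i ∈ A, ((g i).comp (closedSpan x).subtypeL) ⟨v, hv⟩ •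
      (⟨x i, mem_closedSpan x i⟩ : closedSpan x) : closedSpan x) : E) = ∑ i ∈ A, g i v • x i := by
    simp
  have e2 : Finsupp.linearCombination ℝ x a =
      ∑ i ∈ A, g i (Finsupp.linearCombination ℝ x a) • x i := by
    simp only [hg]
    exact linearCombination_eq_sum x hA
  set w := Finsupp.linearCombination ℝ x a
  have hwc : w ∈ closedSpan x := Submodule.le_topologicalClosure _ hw
  have h1 := hproj A (v - w) (Submodule.sub_mem _ hv hwc)
  -- The projection onto `A` fixes `w`, so the error at `v` equals the error at `v - w`.
  have e3 : ∑ i ∈ A, g i v • x i - v = ∑ i ∈ A, g i (v - w) • x i - (v - w) := by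
    simp only [map_sub, sub_smul, Finset.sum_sub_distrib]
    rw [← e2]; abel
  rw [e1, dist_eq_norm, e3]
  rw [dist_eq_norm] at hvw
  calc ‖∑ i ∈ A, g i (v - w) • x i - (v - w)‖ ≤ C * ‖v - w‖ + ‖v - w‖ :=
        (norm_sub_le _ _).trans (by gcongr)
    _ ≤ (|C| + 1) * ‖v - w‖ := by
        nlinarith [le_abs_self C, norm_nonneg (v - w)]
    _ ≤ (|C| + 1) * (ε / (|C| + 2)) := by gcongr
    _ < ε := by
        rw [mul_div_assoc', div_lt_iff₀ (by positivity)]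
        nlinarith

/-- The lower bound passes from the span to its closure, which is complete, so the image is closed
and is therefore the whole closed span of the images. -/
theorem exists_equiv_closedSpan_comp [CompleteSpace E] [CompleteSpace F] (T : E →L[ℝ] F) (z : ι → E)
    {K : ℝ} (hK : 0 ≤ K) (h : ∀ v ∈ Submodule.span ℝ (range z), ‖v‖ ≤ K * ‖T v‖) :
    Nonempty (closedSpan z ≃L[ℝ] closedSpan fun i => T (z i)) := by
  have hbound : ∀ v ∈ closedSpan z, ‖v‖ ≤ K * ‖T v‖ := fun v hv =>
    closure_minimal h
      (isClosed_le continuous_norm (continuous_const.mul T.continuous.norm)) hv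
  have hclosed : IsClosed (closedSpan z : Set E) := Submodule.isClosed_topologicalClosure _
  have : CompleteSpace (closedSpan z) := hclosed.completeSpace_coe
  let S : closedSpan z →L[ℝ] F := T.comp (closedSpan z).subtypeL
  have hanti : AntilipschitzWith K.toNNReal S := by
    refine S.antilipschitz_of_bound fun v => ?_
    rw [Real.coe_toNNReal _ hK]
    exact hbound v v.2
  have hrc : IsClosed (range S) := hanti.isClosed_range S.uniformContinuous
  have hrange : S.range = closedSpan fun i => T (z i) := by
    apply le_antisymm
    · rintro _ ⟨⟨v, hv⟩, rfl⟩
      have hcl : IsClosed (T ⁻¹' (closedSpan fun i => T (z i))) :=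
        (Submodule.isClosed_topologicalClosure _).preimage T.continuous
      refine closure_minimal ?_ hcl hv
      intro v hv
      refine Submodule.span_induction (p := fun v _ => T v ∈ closedSpan fun i => T (z i))
        ?_ ?_ ?_ ?_ hv
      · rintro _ ⟨i, rfl⟩; exact mem_closedSpan (fun i => T (z i)) i
      · simp
      · intro u v _ _ hu hv; rw [map_add]; exact Submodule.add_mem _ hu hv
      · intro c v _ hv; rw [map_smul]; exact Submodule.smul_mem _ c hv
    · refine Submodule.topologicalClosure_minimal _ ?_ hrc
      rw [Submodule.span_le]
      rintro _ ⟨i, rfl⟩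
      exact ⟨⟨z i, mem_closedSpan z i⟩, rfl⟩
  exact ⟨(S.equivRange hanti.injective hrc).trans (ContinuousLinearEquiv.ofEq _ _ hrange)⟩

/-- Both spaces are compared with the closed span of the pairs `(x i, y i)` in `E × F`: equivalence
says that both coordinate projections are bounded below there. -/
theorem SeqEquivalent.exists_equiv_closedSpan [CompleteSpace E] [CompleteSpace F]
    {x : ℕ → E} {y : ℕ → F} (h : SeqEquivalent x y) :
    Nonempty (closedSpan x ≃L[ℝ] closedSpan y) := by
  obtain ⟨C, hC⟩ := h
  let z : ℕ → E × F := fun i => (x i, y i)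
  have hz : ∀ v ∈ Submodule.span ℝ (range z), ‖v.1‖ ≤ C * ‖v.2‖ ∧ ‖v.2‖ ≤ C * ‖v.1‖ := by
    intro v hv
    obtain ⟨a, rfl⟩ := exists_linearCombination_eq hv
    obtain ⟨N, hN⟩ := a.support.exists_nat_subset_range
    rw [linearCombination_eq_sum z hN, Prod.fst_sum, Prod.snd_sum]
    exact hC N a
  have h0 : (0 : ℝ) ≤ max 1 C := le_trans zero_le_one (le_max_left _ _)
  have hmax : ∀ r : ℝ, 0 ≤ r → r ≤ max 1 C * r ∧ C * r ≤ max 1 C * r := fun r hr =>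
    ⟨le_mul_of_one_le_left hr (le_max_left _ _), by gcongr; exact le_max_right _ _⟩
  obtain ⟨e₁⟩ := exists_equiv_closedSpan_comp (ContinuousLinearMap.fst ℝ E F) z h0 fun v hv =>
    max_le (hmax _ (norm_nonneg _)).1 ((hz v hv).2.trans (hmax _ (norm_nonneg _)).2)
  obtain ⟨e₂⟩ := exists_equiv_closedSpan_comp (ContinuousLinearMap.snd ℝ E F) z h0 fun v hv =>
    max_le ((hz v hv).1.trans (hmax _ (norm_nonneg _)).2) (hmax _ (norm_nonneg _)).1
  exact ⟨e₁.symm.trans e₂⟩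

end Banach

/-! ### Totality of the Haar system -/

theorem ae_unitMeasure_mem_Ico : ∀ᵐ x ∂unitMeasure, x ∈ Ico (0 : ℝ) 1 := by
  rw [unitMeasure, ← restrict_Ico_eq_restrict_Icc]
  exact ae_restrict_mem measurableSet_Ico

/-- The function `u` represents an element of the closed span of the Haar system. -/
def InHaarSpan (p : ℝ≥0∞) [Fact (1 ≤ p)] (u : ℝ → ℝ) : Prop :=
  ∃ g ∈ closedSpan (normalizedHaar p), ⇑g =ᵐ[unitMeasure] u

section Haar

variable {p : ℝ≥0∞} [Fact (1 ≤ p)]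

theorem InHaarSpan.congr {u v : ℝ → ℝ} (hu : InHaarSpan p u)
    (h : ∀ x ∈ Ico (0 : ℝ) 1, u x = v x) : InHaarSpan p v := by
  obtain ⟨g, hg, hgu⟩ := hu
  exact ⟨g, hg, hgu.trans (ae_unitMeasure_mem_Ico.mono h)⟩

theorem InHaarSpan.add {u v : ℝ → ℝ} (hu : InHaarSpan p u) (hv : InHaarSpan p v) :
    InHaarSpan p (fun x => u x + v x) := by
  obtain ⟨g, hg, hgu⟩ := hu
  obtain ⟨g', hg', hgv⟩ := hv
  exact ⟨g + g', Submodule.add_mem _ hg hg', (Lp.coeFn_add g g').trans (hgu.add hgv)⟩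

theorem InHaarSpan.const_mul {u : ℝ → ℝ} (hu : InHaarSpan p u) (c : ℝ) :
    InHaarSpan p (fun x => c * u x) := by
  obtain ⟨g, hg, hgu⟩ := hu
  exact ⟨c • g, Submodule.smul_mem _ c hg, (Lp.coeFn_smul c g).trans (hgu.const_smul c)⟩

theorem InHaarSpan.sum {ι : Type*} (s : Finset ι) {u : ι → ℝ → ℝ}
    (hu : ∀ i ∈ s, InHaarSpan p (u i)) : InHaarSpan p (fun x => ∑ i ∈ s, u i x) := by
  classical
  induction s using Finset.induction_on with
  | empty => exact ⟨0, Submodule.zero_mem _, by simpa using! Lp.coeFn_zero ℝ p unitMeasure⟩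
  | insert i s hi ih =>
    simp only [Finset.sum_insert hi]
    exact (hu i (by simp)).add (ih fun j hj => hu j (by simp [hj]))

theorem inHaarSpan_haarFun (n : ℕ) : InHaarSpan p (haarFun n) := by
  refine ⟨haarLp p n, ?_, MemLp.coeFn_toLp _⟩
  by_cases h : haarLp p n = 0
  · rw [h]; exact Submodule.zero_mem _
  · have := Submodule.smul_mem _ ‖haarLp p n‖ (mem_closedSpan (normalizedHaar p) n)
    rwa [normalizedHaar, smul_inv_smul₀ (norm_ne_zero_iff.2 h)] at this

theorem inHaarSpan_dyadicHaar {k m : ℕ} (hm : m < 2 ^ k) : InHaarSpan p (dyadicHaar k m) := by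
  have h := inHaarSpan_haarFun (p := p) (2 ^ k + m)
  have hlog : Nat.log 2 (2 ^ k + m) = k := by
    rw [Nat.log_eq_iff (Or.inr ⟨by norm_num, by positivity⟩)]
    rw [pow_succ]; omega
  rw [haarFun, if_neg (by positivity), hlog, Nat.add_sub_cancel_left] at h
  exact h

/-- The indicator of a dyadic half is half the sum, or half the difference, of the parent's
indicator and the parent's Haar function. -/
theorem inHaarSpan_dyadicIndex (k : ℕ) : ∀ m : ℕ, m < 2 ^ k →
    InHaarSpan p (fun x => if dyadicIndex k x = m then 1 else 0) := by
  induction k with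
  | zero =>
    intro m hm
    obtain rfl : m = 0 := by simpa using hm
    refine (inHaarSpan_haarFun 0).congr fun x hx => ?_
    have := haarIco_zero x
    rw [haarIco, indicator_of_mem hx] at this
    exact this
  | succ k ih =>
    intro m hm
    rw [pow_succ] at hm
    have h1 := ih (m / 2) (by omega)
    have h2 := inHaarSpan_dyadicHaar (p := p) (k := k) (m := m / 2) (by omega)
    rcases Nat.even_or_odd' m with ⟨a, rfl | rfl⟩
    · refine ((h1.add h2).const_mul (1 / 2)).congr fun x _ => ?_
      rw [dyadicHaar_eq, dyadicIndex_eq_succ_div]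
      have ha : 2 * a / 2 = a := by omega
      rw [ha]
      push_cast
      split_ifs <;> first | omega | norm_num
    · refine ((h1.add (h2.const_mul (-1))).const_mul (1 / 2)).congr fun x _ => ?_
      rw [dyadicHaar_eq, dyadicIndex_eq_succ_div]
      have ha : (2 * a + 1) / 2 = a := by omega
      rw [ha]
      push_cast
      split_ifs <;> first | omega | norm_num

theorem inHaarSpan_step (g : ℝ → ℝ) (k : ℕ) :
    InHaarSpan p (fun x => g (dyadicIndex k x / 2 ^ k)) := by
  refine (InHaarSpan.sum (Finset.range (2 ^ k)) (fun m hm =>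
    (inHaarSpan_dyadicIndex (p := p) k m (Finset.mem_range.1 hm)).const_mul
      (g (m / 2 ^ k)))).congr fun x hx => ?_
  have h0 : 0 ≤ dyadicIndex k x := by
    unfold dyadicIndex
    exact Int.floor_nonneg.2 (mul_nonneg (by positivity) hx.1)
  obtain ⟨a, ha⟩ := Int.eq_ofNat_of_zero_le h0
  have h1 : a < 2 ^ k := by
    have h2 : dyadicIndex k x < 2 ^ k := by
      unfold dyadicIndex
      rw [Int.floor_lt]
      push_cast
      have : (0 : ℝ) < 2 ^ k := by positivity
      nlinarith [hx.2]
    rw [ha] at h2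
    exact_mod_cast h2
  rw [ha, Finset.sum_eq_single a]
  · simp
  · intro b _ hb
    have : ¬ ((a : ℤ) = b) := by omega
    simp [this]
  · intro h; exact absurd (Finset.mem_range.2 h1) h

theorem exists_step_close {g : ℝ → ℝ} (hg : Continuous g) {ε : ℝ} (hε : 0 < ε) :
    ∃ k : ℕ, ∀ x ∈ Ico (0 : ℝ) 1, |g (dyadicIndex k x / 2 ^ k) - g x| ≤ ε := by
  have huc := isCompact_Icc.uniformContinuousOn_of_continuous (s := Icc (0 : ℝ) 1) hg.continuousOn
  obtain ⟨δ, hδ, h⟩ := Metric.uniformContinuousOn_iff.1 huc ε hε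
  obtain ⟨k, hk⟩ := exists_pow_lt_of_lt_one hδ (by norm_num : (1 / 2 : ℝ) < 1)
  refine ⟨k, fun x hx => ?_⟩
  have h2k : (0 : ℝ) < 2 ^ k := by positivity
  obtain ⟨h1, h2⟩ := (dyadicIndex_eq_iff (k := k) (x := x)).1 rfl
  have h3 : (0 : ℝ) ≤ dyadicIndex k x := by
    have : 0 ≤ dyadicIndex k x := Int.floor_nonneg.2 (mul_nonneg (by positivity) hx.1)
    exact_mod_cast this
  refine (h _ ⟨by positivity, h1.trans hx.2.le⟩ x (Ico_subset_Icc_self hx) ?_).le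
  rw [add_div] at h2
  rw [div_pow, one_pow] at hk
  rw [Real.dist_eq, abs_lt]
  constructor <;> linarith

/-- Bounded continuous functions are dense in L_p, and dyadic step functions, which lie in the span,
approximate them uniformly on [0,1). -/
theorem closedSpan_normalizedHaar (hp : p ≠ ∞) : closedSpan (normalizedHaar p) = ⊤ := by
  have hcl : IsClosed (closedSpan (normalizedHaar p) : Set (Lp ℝ p unitMeasure)) :=
    Submodule.isClosed_topologicalClosure _
  rw [eq_top_iff]
  rintro f -
  have hd := BoundedContinuousFunction.toLp_denseRange (𝕜 := ℝ) (E := ℝ) (μ := unitMeasure) hp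
  refine closure_minimal ?_ hcl (hd f)
  rintro _ ⟨g, rfl⟩
  rw [← hcl.closure_eq, Metric.mem_closure_iff]
  intro ε hε
  obtain ⟨k, hk⟩ := exists_step_close g.continuous (half_pos hε)
  obtain ⟨w, hw, hwg⟩ := inHaarSpan_step (p := p) g k
  refine ⟨w, hw, lt_of_le_of_lt ?_ (half_lt_self hε)⟩
  rw [dist_comm, dist_eq_norm]
  have hb : ∀ᵐ x ∂unitMeasure, ‖(w - BoundedContinuousFunction.toLp p unitMeasure ℝ g) x‖ ≤ ε / 2 := by
    filter_upwards [Lp.coeFn_sub w (BoundedContinuousFunction.toLp p unitMeasure ℝ g), hwg,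
      BoundedContinuousFunction.coeFn_toLp (𝕜 := ℝ) p unitMeasure g, ae_unitMeasure_mem_Ico]
      with x h1 h2 h3 h4
    rw [h1, Pi.sub_apply, h2, h3]
    exact hk x h4
  -- The total mass is 1, so a uniform bound is a norm bound.
  have := Lp.norm_le_of_ae_bound (half_pos hε).le hb
  simpa [measureUnivNNReal] using this

end Haar

/-! ### `L_p[0, 1]` and `L_p(ℝ)` are isometric -/

section Sigmoid

open Real

/-- Change of variables: the sigmoid maps ℝ bijectively onto (0,1) and has derivative σ(1 - σ),
whose p-th root is the weight in `sigmoidPull`. -/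
theorem lintegral_sigmoid (G : ℝ → ℝ≥0∞) :
    ∫⁻ x, ENNReal.ofReal (sigmoid x * (1 - sigmoid x)) * G (sigmoid x) =
      ∫⁻ y, G y ∂unitMeasure := by
  have h := lintegral_image_eq_lintegral_abs_deriv_mul (s := univ) MeasurableSet.univ
    (f := sigmoid) (fun x _ => (hasDerivAt_sigmoid x).hasDerivWithinAt) sigmoid_injective.injOn G
  rw [image_univ, range_sigmoid, Measure.restrict_univ] at h
  rw [unitMeasure, ← restrict_Ioo_eq_restrict_Icc, h]
  congr 1
  ext x
  rw [abs_of_pos (mul_pos (sigmoid_pos x) (by linarith [sigmoid_lt_one x]))]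

theorem quasiMeasurePreserving_sigmoid :
    Measure.QuasiMeasurePreserving sigmoid volume unitMeasure := by
  refine ⟨continuous_sigmoid.measurable, ?_⟩
  refine Measure.AbsolutelyContinuous.mk fun s hs h => ?_
  rw [Measure.map_apply continuous_sigmoid.measurable hs]
  have h1 := lintegral_sigmoid (s.indicator 1)
  rw [lintegral_indicator_one hs, h, lintegral_eq_zero_iff] at h1
  · rw [measure_eq_zero_iff_ae_notMem]
    filter_upwards [h1] with x hx hxs
    have : sigmoid x ∈ s := hxs
    simp only [Pi.zero_apply, mul_eq_zero, indicator_of_mem this, ENNReal.ofReal_eq_zero] at hx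
    have hpos : 0 < sigmoid x * (1 - sigmoid x) :=
      mul_pos (sigmoid_pos x) (by linarith [sigmoid_lt_one x])
    rcases hx with hx | hx
    · linarith
    · simp at hx
  · have h2 := continuous_sigmoid.measurable
    refine Measurable.mul (by fun_prop) ((measurable_one.indicator hs).comp h2)

/-- The transfer of functions on `[0, 1]` to the line along the sigmoid function. -/
def sigmoidPull (p : ℝ≥0∞) (u : ℝ → ℝ) (x : ℝ) : ℝ :=
  (sigmoid x * (1 - sigmoid x)) ^ (1 / p.toReal) * u (sigmoid x)

variable {p : ℝ≥0∞}

theorem sigmoid_weight_pos (p : ℝ≥0∞) (x : ℝ) :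
    0 < (sigmoid x * (1 - sigmoid x)) ^ (1 / p.toReal) :=
  rpow_pos_of_pos (mul_pos (sigmoid_pos x) (by linarith [sigmoid_lt_one x])) _

theorem measurable_sigmoid_weight (p : ℝ≥0∞) :
    Measurable fun x => (sigmoid x * (1 - sigmoid x)) ^ (1 / p.toReal) := by
  have h2 := continuous_sigmoid.measurable
  fun_prop

theorem eLpNorm_sigmoidPull (hp0 : p ≠ 0) (hp : p ≠ ∞) (u : ℝ → ℝ) :
    eLpNorm (sigmoidPull p u) p volume = eLpNorm u p unitMeasure := by
  rw [eLpNorm_eq_lintegral_rpow_enorm_toReal hp0 hp, eLpNorm_eq_lintegral_rpow_enorm_toReal hp0 hp,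
    ← lintegral_sigmoid]
  congr 2
  ext x
  have hP : 0 < p.toReal := ENNReal.toReal_pos hp0 hp
  have hpos : 0 < sigmoid x * (1 - sigmoid x) :=
    mul_pos (sigmoid_pos x) (by linarith [sigmoid_lt_one x])
  rw [sigmoidPull, enorm_mul, ENNReal.mul_rpow_of_nonneg _ _ hP.le,
    Real.enorm_of_nonneg (sigmoid_weight_pos p x).le,
    ENNReal.ofReal_rpow_of_nonneg (sigmoid_weight_pos p x).le hP.le, ← Real.rpow_mul hpos.le,
    one_div_mul_cancel hP.ne', Real.rpow_one]

theorem memLp_sigmoidPull (hp0 : p ≠ 0) (hp : p ≠ ∞) {u : ℝ → ℝ} (hu : MemLp u p unitMeasure) :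
    MemLp (sigmoidPull p u) p volume := by
  refine ⟨?_, ?_⟩
  · exact (measurable_sigmoid_weight p).aestronglyMeasurable.mul
      (hu.1.comp_quasiMeasurePreserving quasiMeasurePreserving_sigmoid)
  · rw [eLpNorm_sigmoidPull hp0 hp]; exact hu.2

theorem sigmoidPull_congr_ae {u v : ℝ → ℝ} (h : u =ᵐ[unitMeasure] v) :
    sigmoidPull p u =ᵐ[volume] sigmoidPull p v := by
  filter_upwards [quasiMeasurePreserving_sigmoid.ae h] with x hx
  rw [sigmoidPull, sigmoidPull, hx]

variable [Fact (1 ≤ p)]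

/-- The isometric embedding of `L_p[0, 1]` into `L_p(ℝ)` given by `sigmoidPull`. -/
def sigmoidIsometry (hp0 : p ≠ 0) (hp : p ≠ ∞) :
    Lp ℝ p unitMeasure →ₗᵢ[ℝ] Lp ℝ p (volume : Measure ℝ) where
  toFun u := (memLp_sigmoidPull hp0 hp (Lp.memLp u)).toLp _
  map_add' u v := by
    rw [← MemLp.toLp_add]
    refine MemLp.toLp_congr _ _ ((sigmoidPull_congr_ae (Lp.coeFn_add u v)).trans ?_)
    exact Filter.Eventually.of_forall fun x => mul_add _ _ _
  map_smul' c u := by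
    rw [RingHom.id_apply, ← MemLp.toLp_const_smul]
    refine MemLp.toLp_congr _ _ ((sigmoidPull_congr_ae (Lp.coeFn_smul c u)).trans ?_)
    refine Filter.Eventually.of_forall fun x => ?_
    simp only [sigmoidPull, Pi.smul_apply, smul_eq_mul]
    ring
  norm_map' u := by
    simp only [LinearMap.coe_mk, AddHom.coe_mk]
    rw [Lp.norm_toLp, eLpNorm_sigmoidPull hp0 hp, Lp.norm_def]

theorem log_sigmoid_div (x : ℝ) : log (sigmoid x / (1 - sigmoid x)) = x := by
  have h : sigmoid x / (1 - sigmoid x) = exp x := by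
    rw [← sigmoid_neg, ← sigmoid_mul_rexp_neg, div_mul_cancel_left₀ (sigmoid_pos x).ne', exp_neg,
      inv_inv]
  rw [h, log_exp]

theorem surjective_sigmoidIsometry (hp0 : p ≠ 0) (hp : p ≠ ∞) :
    Function.Surjective (sigmoidIsometry (p := p) hp0 hp) := by
  intro F
  let w : ℝ → ℝ := fun x => (sigmoid x * (1 - sigmoid x)) ^ (1 / p.toReal)
  -- The inverse of the sigmoid; the preimage of `F` is `F` transported by it and divided by the
  -- nonvanishing weight.
  let l : ℝ → ℝ := fun y => log (y / (1 - y))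
  let G : ℝ → ℝ := fun y => F (l y) / w (l y)
  have hl : Measurable l := by fun_prop
  have hG : Measurable G := ((Lp.stronglyMeasurable F).measurable.comp hl).div
    ((measurable_sigmoid_weight p).comp hl)
  have hpull : sigmoidPull p G = F := by
    ext x
    have hlx : l (sigmoid x) = x := log_sigmoid_div x
    simp only [sigmoidPull, G, hlx]
    exact mul_div_cancel₀ _ (sigmoid_weight_pos p x).ne'
  have hGm : MemLp G p unitMeasure :=
    ⟨hG.aestronglyMeasurable, by
      rw [← eLpNorm_sigmoidPull hp0 hp, hpull]; exact (Lp.memLp F).2⟩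
  refine ⟨hGm.toLp G, Lp.ext ?_⟩
  refine (MemLp.coeFn_toLp (memLp_sigmoidPull hp0 hp (Lp.memLp (hGm.toLp G)))).trans
    ((sigmoidPull_congr_ae hGm.coeFn_toLp).trans ?_)
  rw [hpull]

end Sigmoid

theorem exists_equiv_closedSpan_normalizedHaar {p : ℝ≥0∞} [Fact (1 ≤ p)] (hp : p ≠ ∞) :
    Nonempty (Lp ℝ p (volume : Measure ℝ) ≃L[ℝ] closedSpan (normalizedHaar p)) := by
  have hp0 : p ≠ 0 := (lt_of_lt_of_le zero_lt_one (Fact.out : 1 ≤ p)).ne'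
  let e := LinearIsometryEquiv.ofSurjective (sigmoidIsometry hp0 hp)
    (surjective_sigmoidIsometry hp0 hp)
  rw [closedSpan_normalizedHaar hp]
  exact ⟨e.symm.toContinuousLinearEquiv.trans Submodule.topContEquiv.symm⟩

/-! ### Gluing functions on the unit interval along the points `3 ^ (j + 1)` -/

/-- The function on the line which is a copy of `g j` on `[3 ^ (j + 1), 3 ^ (j + 1) + 1)` for every
`j`, and zero elsewhere. -/
def glue (g : ℕ → ℝ → ℝ) (x : ℝ) : ℝ :=
  Function.extend (fun j : ℕ => (3 : ℤ) ^ (j + 1)) g 0 ⌊x⌋ (Int.fract x)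

theorem injective_three_pow : Function.Injective fun j : ℕ => (3 : ℤ) ^ (j + 1) := by
  intro i j h
  have := pow_right_injective₀ (a := (3 : ℤ)) (by norm_num) (by norm_num) h
  omega

theorem glue_of_floor_eq {g : ℕ → ℝ → ℝ} {x : ℝ} {j : ℕ} (h : ⌊x⌋ = 3 ^ (j + 1)) :
    glue g x = g j (x - 3 ^ (j + 1)) := by
  rw [glue, Int.fract, h]
  have h3 : Function.extend (fun j : ℕ => (3 : ℤ) ^ (j + 1)) g 0 (3 ^ (j + 1)) = g j :=
    injective_three_pow.extend_apply g 0 j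
  rw [h3]
  push_cast
  rfl

theorem exists_floor_eq_of_glue_ne_zero {g : ℕ → ℝ → ℝ} {x : ℝ} (h : glue g x ≠ 0) :
    ∃ j : ℕ, ⌊x⌋ = 3 ^ (j + 1) := by
  by_contra hx
  refine h ?_
  rw [glue, Function.extend_apply' _ _ _ (fun ⟨j, hj⟩ => hx ⟨j, hj.symm⟩)]
  rfl

theorem glue_add_of_mem {g : ℕ → ℝ → ℝ} {x : ℝ} (hx : x ∈ Ico (0 : ℝ) 1) (i : ℕ) :
    glue g (x + 3 ^ (i + 1)) = g i x := by
  have h : ⌊x + 3 ^ (i + 1)⌋ = 3 ^ (i + 1) := by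
    have h0 : ⌊x⌋ = 0 := Int.floor_eq_zero_iff.2 hx
    have := Int.floor_add_intCast x (3 ^ (i + 1))
    push_cast at this
    rw [this, h0, zero_add]
  rw [glue_of_floor_eq h, add_sub_cancel_right]

/-- The sign tells which exponent is larger, and the larger power dominates: if m < n then 3·3^m ≤
3^n, so unequal leading exponents give different sizes. -/
theorem eq_of_three_pow_sub_eq {a i b k : ℕ} (h : (3 : ℤ) ^ a - 3 ^ i = 3 ^ b - 3 ^ k)
    (hne : (3 : ℤ) ^ a - 3 ^ i ≠ 0) : i = k := by
  have hai : a ≠ i := fun e => hne (by rw [e, sub_self])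
  have hbk : b ≠ k := fun e => hne (by rw [h, e, sub_self])
  have pos : ∀ n : ℕ, (0 : ℤ) < 3 ^ n := fun n => by positivity
  have big : ∀ {m n : ℕ}, m < n → (3 : ℤ) * 3 ^ m ≤ 3 ^ n := fun {m n} hmn => by
    rw [mul_comm, ← pow_succ]
    exact pow_le_pow_right₀ (by norm_num) hmn
  have inj : ∀ {m n : ℕ}, (3 : ℤ) ^ m = 3 ^ n → m = n := fun {m n} e =>
    pow_right_injective₀ (a := (3 : ℤ)) (by norm_num) (by norm_num) e
  have pa := pos a
  have pb := pos b
  have pi := pos i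
  have pk := pos k
  rcases lt_or_gt_of_ne hai with h1 | h1
  · rcases lt_or_gt_of_ne hbk with h2 | h2
    · rcases lt_trichotomy i k with h3 | h3 | h3
      · have := big h1; have := big h2; have := big h3; omega
      · exact h3
      · have := big h1; have := big h2; have := big h3; omega
    · have := big h1; have := big h2; omega
  · rcases lt_or_gt_of_ne hbk with h2 | h2
    · have := big h1; have := big h2; omega
    · rcases lt_trichotomy a b with h3 | h3 | h3
      · have := big h1; have := big h2; have := big h3; omega
      · subst h3
        exact inj (by omega)
      · have := big h1; have := big h2; have := big h3; omega

/-- Disjointness of the translates off [0,1): each nonvanishing one writes `⌊x⌋ ≠ 0` as a difference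
of two powers of 3, which determines the shift. -/
theorem eq_of_glue_ne_zero {g : ℕ → ℝ → ℝ} {x : ℝ} (hx : x ∉ Ico (0 : ℝ) 1) {i k : ℕ}
    (hi : glue g (x + 3 ^ (i + 1)) ≠ 0) (hk : glue g (x + 3 ^ (k + 1)) ≠ 0) : i = k := by
  obtain ⟨a, ha⟩ := exists_floor_eq_of_glue_ne_zero hi
  obtain ⟨b, hb⟩ := exists_floor_eq_of_glue_ne_zero hk
  have h1 := Int.floor_add_intCast x (3 ^ (i + 1))
  have h2 := Int.floor_add_intCast x (3 ^ (k + 1))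
  push_cast at h1 h2
  rw [ha] at h1
  rw [hb] at h2
  have hx0 : ⌊x⌋ ≠ 0 := fun h => hx (Int.floor_eq_zero_iff.1 h)
  have := eq_of_three_pow_sub_eq (a := a + 1) (i := i + 1) (b := b + 1) (k := k + 1)
    (by linarith) (by intro h; apply hx0; linarith)
  omega

theorem measurable_glue {g : ℕ → ℝ → ℝ} (hg : ∀ j, Measurable (g j)) : Measurable (glue g) := by
  have h : Measurable fun z : ℤ × ℝ =>
      Function.extend (fun j : ℕ => (3 : ℤ) ^ (j + 1)) g 0 z.1 z.2 := by
    refine measurable_from_prod_countable_right fun m => ?_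
    by_cases hm : ∃ j : ℕ, (3 : ℤ) ^ (j + 1) = m
    · obtain ⟨j, rfl⟩ := hm
      have h3 : Function.extend (fun j : ℕ => (3 : ℤ) ^ (j + 1)) g 0 (3 ^ (j + 1)) = g j :=
        injective_three_pow.extend_apply g 0 j
      simp only [h3]
      exact hg j
    · simp only [Function.extend_apply' g (0 : ℤ → ℝ → ℝ) m hm]
      exact measurable_const
  exact h.comp (Int.measurable_floor.prodMk measurable_fract)

theorem memLp_glue {g : ℕ → ℝ → ℝ} (hg : ∀ j, Measurable (g j)) {p : ℝ≥0∞} (hp0 : p ≠ 0)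
    (hp : p ≠ ∞) (hsum : ∑' j, ∫⁻ x, ‖g j x‖ₑ ^ p.toReal ≠ ∞) : MemLp (glue g) p volume := by
  refine ⟨(measurable_glue hg).aestronglyMeasurable, ?_⟩
  have hP : 0 < p.toReal := ENNReal.toReal_pos hp0 hp
  rw [eLpNorm_lt_top_iff_lintegral_rpow_enorm_lt_top hp0 hp]
  have hle : ∀ x, ‖glue g x‖ₑ ^ p.toReal ≤ ∑' j : ℕ, ‖g j (x - 3 ^ (j + 1))‖ₑ ^ p.toReal := by
    intro x
    by_cases hx : glue g x = 0
    · simp [hx, hP]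
    · obtain ⟨j, hj⟩ := exists_floor_eq_of_glue_ne_zero hx
      rw [glue_of_floor_eq hj]
      exact ENNReal.le_tsum (f := fun j : ℕ => ‖g j (x - 3 ^ (j + 1))‖ₑ ^ p.toReal) j
  refine (lintegral_mono hle).trans_lt ?_
  rw [lintegral_tsum fun j => by
    have := hg j
    fun_prop]
  have he : ∀ j : ℕ, ∫⁻ x, ‖g j (x - 3 ^ (j + 1))‖ₑ ^ p.toReal = ∫⁻ x, ‖g j x‖ₑ ^ p.toReal :=
    fun j => lintegral_sub_right_eq_self (fun x => ‖g j x‖ₑ ^ p.toReal) _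
  simp only [he]
  exact lt_top_iff_ne_top.2 hsum

/-! ### Norms of combinations of translates -/

theorem coeFn_translateLp {p : ℝ≥0∞} {f : ℝ → ℝ} (hf : MemLp f p volume) (t : ℝ) :
    ⇑(translateLp (hf.toLp f) t) =ᵐ[volume] fun x => f (x - t) := by
  refine (Lp.coeFn_compMeasurePreserving _ _).trans ?_
  exact (measurePreserving_sub_right volume t).quasiMeasurePreserving.ae_eq_comp hf.coeFn_toLp

theorem norm_rpow_eq_integral {α : Type*} [MeasurableSpace α] {μ : Measure α} {p : ℝ≥0∞} {q : ℝ}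
    (hq : 0 < q) (hp : p = ENNReal.ofReal (2 * q)) {F : Lp ℝ p μ} {u : α → ℝ}
    (h : ⇑F =ᵐ[μ] u) : ‖F‖ ^ (2 * q) = ∫ x, (u x ^ 2) ^ q ∂μ := by
  subst hp
  have hP : 0 < 2 * q := by linarith
  rw [Lp.norm_def, eLpNorm_congr_ae h]
  have hu : MemLp u (ENNReal.ofReal (2 * q)) μ := (memLp_congr_ae h).1 (Lp.memLp F)
  rw [hu.eLpNorm_eq_integral_rpow_norm (by simpa using hP) ENNReal.ofReal_ne_top,
    ENNReal.toReal_ofReal hP.le, ENNReal.toReal_ofReal (by positivity), ← Real.rpow_mul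
    (by positivity), inv_mul_cancel₀ hP.ne', Real.rpow_one]
  simp only [sq_rpow_eq, Real.norm_eq_abs]

/-- The `j`-th translate of the glued function. -/
def glueTranslate {g : ℕ → ℝ → ℝ} {p : ℝ≥0∞} (h : MemLp (glue g) p volume) (j : ℕ) :
    Lp ℝ p (volume : Measure ℝ) :=
  translateLp (h.toLp (glue g)) (-(3 ^ (j + 1)))

/-- The part of the norm of the `i`-th translate carried by the complement of `[0, 1)`. -/
def tailMass (g : ℕ → ℝ → ℝ) (q : ℝ) (i : ℕ) : ℝ :=
  ∫ x in (Ico (0 : ℝ) 1)ᶜ, (glue g (x + 3 ^ (i + 1)) ^ 2) ^ q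

theorem tailMass_nonneg (g : ℕ → ℝ → ℝ) (q : ℝ) (i : ℕ) : 0 ≤ tailMass g q i :=
  integral_nonneg fun _ => Real.rpow_nonneg (sq_nonneg _) _

theorem integrable_sq_rpow {α : Type*} [MeasurableSpace α] {μ : Measure α} {q : ℝ} (hq : 0 < q)
    {u : α → ℝ} (h : MemLp u (ENNReal.ofReal (2 * q)) μ) :
    Integrable (fun x => (u x ^ 2) ^ q) μ := by
  simpa only [sq_rpow_eq] using integrable_abs_rpow_of_memLp (by linarith) h

theorem memLp_glue_add {g : ℕ → ℝ → ℝ} {p : ℝ≥0∞} (h : MemLp (glue g) p volume) (t : ℝ) :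
    MemLp (fun x => glue g (x + t)) p volume :=
  h.comp_measurePreserving (measurePreserving_add_right volume t)

theorem tailMass_le {g : ℕ → ℝ → ℝ} {q : ℝ} (hq : 0 < q)
    (h : MemLp (glue g) (ENNReal.ofReal (2 * q)) volume) (i : ℕ) :
    tailMass g q i ≤ ∫ x, (glue g x ^ 2) ^ q := by
  have h1 := integrable_sq_rpow hq (memLp_glue_add h (3 ^ (i + 1)))
  refine (setIntegral_le_integral h1
    (Filter.Eventually.of_forall fun _ => Real.rpow_nonneg (sq_nonneg _) _)).trans_eq ?_
  exact integral_add_right_eq_self (fun x => (glue g x ^ 2) ^ q) _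

/-- On [0,1) the translates are the `g i`; on the complement at most one of them is nonzero at each
point, so there the p-th powers add. -/
theorem norm_sum_glueTranslate {g : ℕ → ℝ → ℝ} {q : ℝ} (hq : 0 < q) {p : ℝ≥0∞}
    (hp : p = ENNReal.ofReal (2 * q)) (hg0 : ∀ j x, x ∉ Ico (0 : ℝ) 1 → g j x = 0)
    (h : MemLp (glue g) p volume) [Fact (1 ≤ p)] (A : Finset ℕ) (a : ℕ → ℝ) :
    ‖∑ i ∈ A, a i • glueTranslate h i‖ ^ (2 * q) =
      (∫ x, ((∑ i ∈ A, a i * g i x) ^ 2) ^ q) + ∑ i ∈ A, (a i ^ 2) ^ q * tailMass g q i := by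
  have hae : ⇑(∑ i ∈ A, a i • glueTranslate h i) =ᵐ[volume]
      fun x => ∑ i ∈ A, a i * glue g (x + 3 ^ (i + 1)) := by
    refine (Lp.coeFn_finsetSum _ _).trans ?_
    have h1 : ∀ i ∈ A, ∀ᵐ x, (a i • glueTranslate h i) x = a i * glue g (x + 3 ^ (i + 1)) := by
      intro i _
      filter_upwards [Lp.coeFn_smul (a i) (glueTranslate h i),
        coeFn_translateLp h (-(3 ^ (i + 1)))] with x h1 h2
      rw [h1, Pi.smul_apply, glueTranslate, h2, sub_neg_eq_add, smul_eq_mul]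
    filter_upwards [(Filter.eventually_all_finset A).2 h1] with x hx
    rw [Finset.sum_apply]
    exact Finset.sum_congr rfl hx
  rw [norm_rpow_eq_integral hq hp hae]
  subst hp
  have hm : MemLp (fun x => ∑ i ∈ A, a i * glue g (x + 3 ^ (i + 1))) (ENNReal.ofReal (2 * q))
      volume := memLp_finsetSum _ fun i _ => (memLp_glue_add h _).const_mul _
  rw [← integral_add_compl measurableSet_Ico (integrable_sq_rpow hq hm)]
  congr 1
  · rw [← setIntegral_eq_integral_of_forall_compl_eq_zero (s := Ico (0 : ℝ) 1)
      (f := fun x => ((∑ i ∈ A, a i * g i x) ^ 2) ^ q)]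
    · refine setIntegral_congr_fun measurableSet_Ico fun x hx => ?_
      simp only [glue_add_of_mem hx]
    · intro x hx
      simp [hg0 _ x hx, hq.ne']
  · have hpt : ∀ x ∈ (Ico (0 : ℝ) 1)ᶜ, ((∑ i ∈ A, a i * glue g (x + 3 ^ (i + 1))) ^ 2) ^ q =
        ∑ i ∈ A, (a i ^ 2) ^ q * (glue g (x + 3 ^ (i + 1)) ^ 2) ^ q := by
      intro x hx
      by_cases hex : ∃ k ∈ A, glue g (x + 3 ^ (k + 1)) ≠ 0
      · obtain ⟨k, hkA, hk⟩ := hex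
        have hz : ∀ i ∈ A, i ≠ k → glue g (x + 3 ^ (i + 1)) = 0 := fun i _ hik => by
          by_contra hi
          exact hik (eq_of_glue_ne_zero hx hi hk)
        rw [Finset.sum_eq_single_of_mem k hkA fun i hi hik => by rw [hz i hi hik, mul_zero],
          Finset.sum_eq_single_of_mem k hkA fun i hi hik => by rw [hz i hi hik]; simp [hq.ne'],
          mul_pow, Real.mul_rpow (sq_nonneg _) (sq_nonneg _)]
      · push Not at hex
        rw [Finset.sum_eq_zero fun i hi => by rw [hex i hi, mul_zero],
          Finset.sum_eq_zero fun i hi => by rw [hex i hi]; simp [hq.ne']]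
        simp [hq.ne']
    rw [setIntegral_congr_fun measurableSet_Ico.compl hpt, integral_finsetSum]
    · simp only [integral_const_mul, tailMass]
    · intro i _
      exact ((integrable_sq_rpow hq (memLp_glue_add h _)).const_mul _).integrableOn

/-! ### Square functions over finite index sets -/

theorem SignSymmetric.square_function_finset {α : Type*} [MeasurableSpace α] {μ : Measure α}
    {d : ℕ → α → ℝ} (h : SignSymmetric μ d) {q : ℝ}
    (hq : 3 / 2 ≤ q) (hd : ∀ k, MemLp (d k) (ENNReal.ofReal (2 * q)) μ) (A : Finset ℕ) (c : ℕ → ℝ) :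
    ∫ x, (∑ i ∈ A, (c i * d i x) ^ 2) ^ q ∂μ ≤
        squareConst q * ∫ x, ((∑ i ∈ A, c i * d i x) ^ 2) ^ q ∂μ ∧
      ∫ x, ((∑ i ∈ A, c i * d i x) ^ 2) ^ q ∂μ ≤
        squareConst q * ∫ x, (∑ i ∈ A, (c i * d i x) ^ 2) ^ q ∂μ := by
  classical
  obtain ⟨N, hN⟩ := A.exists_nat_subset_range
  have key := (h.smul fun i => if i ∈ A then c i else 0).square_function hq
    (fun k => (hd k).const_mul _) N
  have e1 : ∀ x, ∑ i ∈ Finset.range N, (if i ∈ A then c i else 0) * d i x =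
      ∑ i ∈ A, c i * d i x := fun x => by
    rw [← Finset.sum_subset hN fun i _ hi => by simp [hi]]
    exact Finset.sum_congr rfl fun i hi => by simp [hi]
  have e2 : ∀ x, ∑ i ∈ Finset.range N, ((if i ∈ A then c i else 0) * d i x) ^ 2 =
      ∑ i ∈ A, (c i * d i x) ^ 2 := fun x => by
    rw [← Finset.sum_subset hN fun i _ hi => by simp [hi]]
    exact Finset.sum_congr rfl fun i hi => by simp [hi]
  simp only [e1, e2] at key
  exact key

theorem integrable_sum_sq_rpow_finset {α : Type*} [MeasurableSpace α] {μ : Measure α}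
    {d : ℕ → α → ℝ} {q : ℝ} (hq : 3 / 2 ≤ q)
    (hd : ∀ k, MemLp (d k) (ENNReal.ofReal (2 * q)) μ) (A : Finset ℕ) (c : ℕ → ℝ) :
    Integrable (fun x => (∑ i ∈ A, (c i * d i x) ^ 2) ^ q) μ := by
  classical
  obtain ⟨N, hN⟩ := A.exists_nat_subset_range
  have key := integrable_sum_sq_rpow (d := fun i x => (if i ∈ A then c i else 0) * d i x) hq
    (fun k => (hd k).const_mul _) N
  have e2 : ∀ x, ∑ i ∈ Finset.range N, ((if i ∈ A then c i else 0) * d i x) ^ 2 =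
      ∑ i ∈ A, (c i * d i x) ^ 2 := fun x => by
    rw [← Finset.sum_subset hN fun i _ hi => by simp [hi]]
    exact Finset.sum_congr rfl fun i hi => by simp [hi]
  simpa only [e2] using key

/-- The square function is monotone in the index set; passing to it and back costs one constant each
way. -/
theorem SignSymmetric.integral_sum_le_of_subset {α : Type*} [MeasurableSpace α] {μ : Measure α}
    {d : ℕ → α → ℝ} (h : SignSymmetric μ d) {q : ℝ} (hq : 3 / 2 ≤ q)
    (hd : ∀ k, MemLp (d k) (ENNReal.ofReal (2 * q)) μ) {A B : Finset ℕ} (hAB : A ⊆ B)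
    (c : ℕ → ℝ) :
    ∫ x, ((∑ i ∈ A, c i * d i x) ^ 2) ^ q ∂μ ≤
      squareConst q ^ 2 * ∫ x, ((∑ i ∈ B, c i * d i x) ^ 2) ^ q ∂μ := by
  have h1 := (h.square_function_finset hq hd A c).2
  have h2 := (h.square_function_finset hq hd B c).1
  have h3 : ∫ x, (∑ i ∈ A, (c i * d i x) ^ 2) ^ q ∂μ ≤
      ∫ x, (∑ i ∈ B, (c i * d i x) ^ 2) ^ q ∂μ := by
    refine integral_mono (integrable_sum_sq_rpow_finset hq hd A c)
      (integrable_sum_sq_rpow_finset hq hd B c) fun x => ?_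
    refine Real.rpow_le_rpow (Finset.sum_nonneg fun i _ => sq_nonneg _) ?_ (by linarith)
    exact Finset.sum_le_sum_of_subset_of_nonneg hAB fun i _ _ => sq_nonneg _
  have hC := (squareConst_pos hq).le
  calc _ ≤ squareConst q * (squareConst q * ∫ x, ((∑ i ∈ B, c i * d i x) ^ 2) ^ q ∂μ) :=
        h1.trans (mul_le_mul_of_nonneg_left (h3.trans h2) hC)
    _ = _ := by ring

theorem le_mul_of_rpow_le {a b C r : ℝ} (ha : 0 ≤ a) (hb : 0 ≤ b) (hC : 0 ≤ C) (hr : 0 < r)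
    (h : a ^ r ≤ C * b ^ r) : a ≤ C ^ r⁻¹ * b := by
  rw [← Real.rpow_le_rpow_iff ha (by positivity) hr, Real.mul_rpow (by positivity) hb,
    ← Real.rpow_mul hC, inv_mul_cancel₀ hr.ne', Real.rpow_one]
  exact h

/-- The integral over [0,1) loses `squareConst q ^ 2`, the tail sum loses nothing; hence the maximum
with 1. -/
theorem norm_sum_glueTranslate_le_of_subset {g : ℕ → ℝ → ℝ} (hsym : SignSymmetric volume g) {q : ℝ}
    (hq : 3 / 2 ≤ q) {p : ℝ≥0∞} (hp : p = ENNReal.ofReal (2 * q))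
    (hg : ∀ j, MemLp (g j) p volume) (hg0 : ∀ j x, x ∉ Ico (0 : ℝ) 1 → g j x = 0)
    (h : MemLp (glue g) p volume) [Fact (1 ≤ p)] {A B : Finset ℕ} (hAB : A ⊆ B) (a : ℕ → ℝ) :
    ‖∑ i ∈ A, a i • glueTranslate h i‖ ≤
      (max 1 (squareConst q ^ 2)) ^ (2 * q)⁻¹ * ‖∑ i ∈ B, a i • glueTranslate h i‖ := by
  have hq0 : 0 < q := by linarith
  have h1 : (1 : ℝ) ≤ max 1 (squareConst q ^ 2) := le_max_left _ _
  have h2 : squareConst q ^ 2 ≤ max 1 (squareConst q ^ 2) := le_max_right _ _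
  refine le_mul_of_rpow_le (norm_nonneg _) (norm_nonneg _) (by linarith) (by linarith) ?_
  rw [norm_sum_glueTranslate hq0 hp hg0 h, norm_sum_glueTranslate hq0 hp hg0 h]
  subst hp
  have h3 := hsym.integral_sum_le_of_subset hq hg hAB a
  have h4 : ∑ i ∈ A, (a i ^ 2) ^ q * tailMass g q i ≤ ∑ i ∈ B, (a i ^ 2) ^ q * tailMass g q i :=
    Finset.sum_le_sum_of_subset_of_nonneg hAB fun i _ _ =>
      mul_nonneg (Real.rpow_nonneg (sq_nonneg _) _) (tailMass_nonneg g q i)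
  have h5 : 0 ≤ ∑ i ∈ B, (a i ^ 2) ^ q * tailMass g q i := Finset.sum_nonneg fun i _ =>
      mul_nonneg (Real.rpow_nonneg (sq_nonneg _) _) (tailMass_nonneg g q i)
  have h6 : 0 ≤ ∫ x, ((∑ i ∈ B, a i * g i x) ^ 2) ^ q :=
    integral_nonneg fun _ => Real.rpow_nonneg (sq_nonneg _) _
  rw [mul_add]
  exact add_le_add (h3.trans (mul_le_mul_of_nonneg_right h2 h6))
    (h4.trans (le_mul_of_one_le_left h5 h1))

/-! ### Blocks of indices -/

/-- The first index of the `n`-th block, when the `n`-th block has length `K n ^ 4`. -/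
def blockStart (K : ℕ → ℕ) (n : ℕ) : ℕ := ∑ i ∈ Finset.range n, K i ^ 4

/-- The number of the block containing the index `j`. -/
def blockIndex (K : ℕ → ℕ) (j : ℕ) : ℕ := Nat.findGreatest (fun n => blockStart K n ≤ j) j

theorem blockStart_succ (K : ℕ → ℕ) (n : ℕ) :
    blockStart K (n + 1) = blockStart K n + K n ^ 4 := Finset.sum_range_succ _ _

theorem strictMono_blockStart {K : ℕ → ℕ} (hK : ∀ n, 1 ≤ K n) : StrictMono (blockStart K) :=
  strictMono_nat_of_lt_succ fun n => by
    have : 0 < K n ^ 4 := Nat.pow_pos (hK n)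
    rw [blockStart_succ]; omega

theorem blockIndex_le (K : ℕ → ℕ) (j : ℕ) : blockIndex K j ≤ j := Nat.findGreatest_le j

theorem blockIndex_eq {K : ℕ → ℕ} (hK : ∀ n, 1 ≤ K n) {n j : ℕ}
    (h : j ∈ Finset.Ico (blockStart K n) (blockStart K (n + 1))) : blockIndex K j = n := by
  obtain ⟨h1, h2⟩ := Finset.mem_Ico.1 h
  have hm := strictMono_blockStart hK
  rw [blockIndex, Nat.findGreatest_eq_iff]
  refine ⟨hm.le_apply.trans h1, fun _ => h1, fun k hk _ hk' => ?_⟩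
  have := hm.monotone (Nat.succ_le_of_lt hk)
  rw [Nat.succ_eq_add_one] at this
  omega

theorem sum_range_blockStart {M : Type*} [AddCommMonoid M] {K : ℕ → ℕ} (hK : ∀ n, 1 ≤ K n)
    (φ : ℕ → M) (N : ℕ) : ∑ j ∈ Finset.range (blockStart K N), φ j =
      ∑ n ∈ Finset.range N, ∑ j ∈ Finset.Ico (blockStart K n) (blockStart K (n + 1)), φ j := by
  induction N with
  | zero => simp [blockStart]
  | succ N ih =>
    rw [Finset.sum_range_succ, ← ih,
      Finset.sum_range_add_sum_Ico φ ((strictMono_blockStart hK).monotone (Nat.le_succ N))]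

theorem sum_range_blockStart_blockIndex {K : ℕ → ℕ} (hK : ∀ n, 1 ≤ K n) (φ : ℕ → ℝ) (N : ℕ) :
    ∑ j ∈ Finset.range (blockStart K N), φ (blockIndex K j) =
      ∑ n ∈ Finset.range N, (K n : ℝ) ^ 4 * φ n := by
  rw [sum_range_blockStart hK]
  refine Finset.sum_congr rfl fun n _ => ?_
  rw [Finset.sum_congr rfl fun j hj => by rw [blockIndex_eq hK hj], Finset.sum_const,
    Nat.card_Ico, blockStart_succ, Nat.add_sub_cancel_left, nsmul_eq_mul]
  push_cast
  rfl

/-- k^(4-P) tends to 0 because P > 4. The bound serves twice: it puts the glued function in L_p and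
makes the tails of the block vectors summable. -/
theorem exists_block_sizes {P : ℝ} (hP : 4 < P) : ∃ K : ℕ → ℕ, (∀ n, 1 ≤ K n) ∧
    ∀ n, (K n : ℝ) ^ 4 * ((K n : ℝ) ^ P)⁻¹ ≤ (1 / 2) ^ n := by
  have h : ∀ n : ℕ, ∃ k : ℕ, 1 ≤ k ∧ (k : ℝ) ^ 4 * ((k : ℝ) ^ P)⁻¹ ≤ (1 / 2) ^ n := by
    intro n
    have ht : Filter.Tendsto (fun k : ℕ => (k : ℝ) ^ (-(P - 4))) Filter.atTop (nhds 0) :=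
      (tendsto_rpow_neg_atTop (by linarith)).comp tendsto_natCast_atTop_atTop
    have hev := ht.eventually (gt_mem_nhds (show (0 : ℝ) < (1 / 2) ^ n by positivity))
    obtain ⟨k, hk, hk1⟩ := (hev.and (Filter.eventually_ge_atTop 1)).exists
    refine ⟨k, hk1, le_trans (le_of_eq ?_) hk.le⟩
    have hk0 : (0 : ℝ) < k := by exact_mod_cast hk1
    rw [← Real.rpow_natCast, ← Real.rpow_neg hk0.le, ← Real.rpow_add hk0]
    congr 1
    push_cast
    ring
  choose K h1 h2 using h
  exact ⟨K, h1, h2⟩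

/-! ### Norms of Haar functions -/

theorem haarFun_ae_eq_haarIco (n : ℕ) : haarFun n =ᵐ[unitMeasure] haarIco n :=
  ae_unitMeasure_mem_Ico.mono fun x hx => by rw [haarIco, indicator_of_mem hx]

theorem exists_haarIco_eq_one (n : ℕ) :
    ∃ (k : ℕ) (m : ℤ), ∀ x, dyadicIndex k x = m → haarIco n x = 1 := by
  rcases eq_or_ne n 0 with rfl | hn
  · exact ⟨0, 0, fun x hx => by rw [haarIco_zero, if_pos hx]⟩
  · exact ⟨Nat.log 2 n + 1, 2 * haarPos n, fun x hx => by rw [haarIco_of_ne_zero hn, if_pos hx]⟩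

theorem haarIco_not_ae_eq_zero (n : ℕ) : ¬ haarIco n =ᵐ[unitMeasure] 0 := by
  intro h
  obtain ⟨k, m, hkm⟩ := exists_haarIco_eq_one n
  have hsub : Ico ((m : ℝ) / 2 ^ k) ((m + 1) / 2 ^ k) ⊆ Icc 0 1 := fun x hx => by
    have h1 := hkm x (dyadicIndex_eq_iff.2 hx)
    by_contra hx'
    rw [haarIco_of_notMem n fun h => hx' (Ico_subset_Icc_self h)] at h1
    exact zero_ne_one h1
  have h0 : unitMeasure (Ico ((m : ℝ) / 2 ^ k) ((m + 1) / 2 ^ k)) = 0 := by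
    rw [measure_eq_zero_iff_ae_notMem]
    filter_upwards [h] with x hx hx'
    rw [hkm x (dyadicIndex_eq_iff.2 hx')] at hx
    exact one_ne_zero hx
  rw [Measure.restrict_apply measurableSet_Ico, inter_eq_left.2 hsub, Real.volume_Ico,
    ENNReal.ofReal_eq_zero, ← sub_div] at h0
  have : (0 : ℝ) < (m + 1 - m) / 2 ^ k := by
    rw [add_sub_cancel_left]; positivity
  linarith

theorem haarLp_ne_zero {p : ℝ≥0∞} (n : ℕ) : haarLp p n ≠ 0 := by
  intro h
  refine haarIco_not_ae_eq_zero n ?_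
  have h1 := (Lp.eq_zero_iff_ae_eq_zero).1 h
  exact (haarFun_ae_eq_haarIco n).symm.trans ((MemLp.coeFn_toLp (memLp_haarFun p n)).symm.trans h1)

/-- The `L_p`-normalized Haar functions on `[0, 1)`. -/
def unitHaar (p : ℝ≥0∞) (n : ℕ) (x : ℝ) : ℝ := ‖haarLp p n‖⁻¹ * haarIco n x

theorem unitHaar_of_notMem (p : ℝ≥0∞) (n : ℕ) {x : ℝ} (hx : x ∉ Ico (0 : ℝ) 1) :
    unitHaar p n x = 0 := by
  rw [unitHaar, haarIco_of_notMem n hx, mul_zero]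

theorem memLp_unitHaar (p r : ℝ≥0∞) (n : ℕ) : MemLp (unitHaar p n) r volume :=
  (memLp_haarIco r n).const_mul _

section

variable {p : ℝ≥0∞} {q : ℝ}

theorem norm_normalizedHaar [Fact (1 ≤ p)] (n : ℕ) : ‖normalizedHaar p n‖ = 1 := by
  rw [normalizedHaar, norm_smul, norm_inv, norm_norm,
    inv_mul_cancel₀ (norm_ne_zero_iff.2 (haarLp_ne_zero n))]

theorem norm_sum_normalizedHaar (hq : 0 < q) (hp : p = ENNReal.ofReal (2 * q)) (A : Finset ℕ)
    (c : ℕ → ℝ) : ‖∑ n ∈ A, c n • normalizedHaar p n‖ ^ (2 * q) =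
      ∫ x, ((∑ n ∈ A, c n * unitHaar p n x) ^ 2) ^ q := by
  have hae : ⇑(∑ n ∈ A, c n • normalizedHaar p n) =ᵐ[unitMeasure]
      fun x => ∑ n ∈ A, c n * unitHaar p n x := by
    refine (Lp.coeFn_finsetSum _ _).trans ?_
    have h1 : ∀ n ∈ A, ∀ᵐ x ∂unitMeasure, (c n • normalizedHaar p n) x = c n * unitHaar p n x := by
      intro n _
      filter_upwards [Lp.coeFn_smul (c n) (normalizedHaar p n),
        Lp.coeFn_smul (‖haarLp p n‖⁻¹) (haarLp p n), MemLp.coeFn_toLp (memLp_haarFun p n),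
        haarFun_ae_eq_haarIco n] with x h1 h2 h3 h4
      rw [h1, Pi.smul_apply, normalizedHaar, h2, Pi.smul_apply, haarLp, h3, h4]
      rfl
    filter_upwards [(Filter.eventually_all_finset A).2 h1] with x hx
    rw [Finset.sum_apply]
    exact Finset.sum_congr rfl hx
  rw [norm_rpow_eq_integral hq hp hae]
  refine setIntegral_eq_integral_of_forall_compl_eq_zero fun x hx => ?_
  have hx' : x ∉ Ico (0 : ℝ) 1 := fun h => hx (Ico_subset_Icc_self h)
  simp [unitHaar_of_notMem p _ hx', hq.ne']

theorem integral_unitHaar [Fact (1 ≤ p)] (hq : 0 < q) (hp : p = ENNReal.ofReal (2 * q)) (n : ℕ) :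
    ∫ x, (unitHaar p n x ^ 2) ^ q = 1 := by
  have h := norm_sum_normalizedHaar hq hp {n} 1
  simp only [Finset.sum_singleton, Pi.one_apply, one_smul, one_mul, norm_normalizedHaar,
    Real.one_rpow] at h
  exact h.symm

end

theorem signSymmetric_unitHaar (p : ℝ≥0∞) : SignSymmetric volume (unitHaar p) :=
  signSymmetric_haarIco.smul fun n => ‖haarLp p n‖⁻¹

/-! ### The functions to be glued -/

/-- The function `K n ^ (-1) * unitHaar n * rademacher (j + 2)`, where `n` is the block of `j`. -/
def pieceFun (p : ℝ≥0∞) (K : ℕ → ℕ) (j : ℕ) (x : ℝ) : ℝ :=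
  (K (blockIndex K j) : ℝ)⁻¹ * (unitHaar p (blockIndex K j) x * rademacher (j + 2) x)

theorem signSymmetric_pieceFun (p : ℝ≥0∞) (K : ℕ → ℕ) : SignSymmetric volume (pieceFun p K) := by
  have h := (signSymmetric_haarIco_mul_rademacher (blockIndex_le K)).smul
    fun j => (K (blockIndex K j) : ℝ)⁻¹ * ‖haarLp p (blockIndex K j)‖⁻¹
  convert h using 3
  rw [pieceFun, unitHaar]
  ring

theorem measurable_pieceFun (p : ℝ≥0∞) (K : ℕ → ℕ) (j : ℕ) : Measurable (pieceFun p K j) :=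
  (((measurable_haarIco _).const_mul _).mul (measurable_rademacher _)).const_mul _

theorem pieceFun_sq (p : ℝ≥0∞) (K : ℕ → ℕ) (j : ℕ) (x : ℝ) : pieceFun p K j x ^ 2 =
    ((K (blockIndex K j) : ℝ)⁻¹) ^ 2 * unitHaar p (blockIndex K j) x ^ 2 := by
  rw [pieceFun, mul_pow, mul_pow, rademacher_sq, mul_one]

theorem pieceFun_of_notMem (p : ℝ≥0∞) (K : ℕ → ℕ) (j : ℕ) {x : ℝ} (hx : x ∉ Ico (0 : ℝ) 1) :
    pieceFun p K j x = 0 := by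
  rw [pieceFun, unitHaar_of_notMem p _ hx, zero_mul, mul_zero]

theorem abs_pieceFun (p : ℝ≥0∞) (K : ℕ → ℕ) (j : ℕ) (x : ℝ) : |pieceFun p K j x| =
    (K (blockIndex K j) : ℝ)⁻¹ * |unitHaar p (blockIndex K j) x| := by
  rw [← Real.sqrt_sq_eq_abs, pieceFun_sq, ← mul_pow, Real.sqrt_sq_eq_abs, abs_mul,
    abs_of_nonneg (by positivity : (0 : ℝ) ≤ (K (blockIndex K j) : ℝ)⁻¹)]

theorem memLp_pieceFun (p r : ℝ≥0∞) (K : ℕ → ℕ) (j : ℕ) : MemLp (pieceFun p K j) r volume := by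
  refine ((memLp_unitHaar p r (blockIndex K j)).const_mul (K (blockIndex K j) : ℝ)⁻¹).mono
    (measurable_pieceFun p K j).aestronglyMeasurable (Filter.Eventually.of_forall fun x => ?_)
  rw [Real.norm_eq_abs, abs_pieceFun, Real.norm_eq_abs, abs_mul,
    abs_of_nonneg (by positivity : (0 : ℝ) ≤ (K (blockIndex K j) : ℝ)⁻¹)]

/-! ### The glued function in L_p and its block vectors -/

section

variable {p : ℝ≥0∞} {q : ℝ} {K : ℕ → ℕ}

theorem inv_sq_rpow {k : ℝ} (hk : 0 ≤ k) (q : ℝ) : (k⁻¹ ^ 2) ^ q = (k ^ (2 * q))⁻¹ := by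
  rw [sq_rpow_eq, abs_of_nonneg (by positivity), Real.inv_rpow hk]

theorem integral_pieceFun [Fact (1 ≤ p)] (hq : 0 < q) (hp : p = ENNReal.ofReal (2 * q)) (j : ℕ) :
    ∫ x, (pieceFun p K j x ^ 2) ^ q = ((K (blockIndex K j) : ℝ) ^ (2 * q))⁻¹ := by
  simp only [pieceFun_sq]
  simp only [Real.mul_rpow (sq_nonneg _) (sq_nonneg _)]
  rw [integral_const_mul, integral_unitHaar hq hp, mul_one, inv_sq_rpow (by positivity)]

theorem summable_block (hK : ∀ n, 1 ≤ K n)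
    (hK2 : ∀ n, (K n : ℝ) ^ 4 * ((K n : ℝ) ^ (2 * q))⁻¹ ≤ (1 / 2) ^ n) :
    Summable fun j => ((K (blockIndex K j) : ℝ) ^ (2 * q))⁻¹ := by
  have h0 : ∀ j, 0 ≤ ((K (blockIndex K j) : ℝ) ^ (2 * q))⁻¹ := fun j => by positivity
  refine summable_of_sum_range_le (c := 2) h0 fun N => ?_
  calc ∑ j ∈ Finset.range N, ((K (blockIndex K j) : ℝ) ^ (2 * q))⁻¹
      ≤ ∑ j ∈ Finset.range (blockStart K N), ((K (blockIndex K j) : ℝ) ^ (2 * q))⁻¹ :=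
        -- Every block is nonempty, so `N ≤ blockStart K N`, and a partial sum can be completed to
        -- whole blocks.
        Finset.sum_le_sum_of_subset_of_nonneg
          (Finset.range_mono (strictMono_blockStart hK).le_apply) fun j _ _ => h0 j
    _ = ∑ n ∈ Finset.range N, (K n : ℝ) ^ 4 * ((K n : ℝ) ^ (2 * q))⁻¹ :=
        sum_range_blockStart_blockIndex hK (fun n => ((K n : ℝ) ^ (2 * q))⁻¹) N
    _ ≤ ∑ n ∈ Finset.range N, (1 / 2 : ℝ) ^ n := Finset.sum_le_sum fun n _ => hK2 n
    _ ≤ 2 := sum_geometric_two_le N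

theorem memLp_glue_pieceFun [Fact (1 ≤ p)] (hq : 0 < q) (hp : p = ENNReal.ofReal (2 * q))
    (hK : ∀ n, 1 ≤ K n)
    (hK2 : ∀ n, (K n : ℝ) ^ 4 * ((K n : ℝ) ^ (2 * q))⁻¹ ≤ (1 / 2) ^ n) :
    MemLp (glue (pieceFun p K)) p volume := by
  have hp0 : p ≠ 0 := (lt_of_lt_of_le zero_lt_one (Fact.out : 1 ≤ p)).ne'
  have hpt : p ≠ ∞ := by rw [hp]; exact ENNReal.ofReal_ne_top
  have hP : p.toReal = 2 * q := by rw [hp, ENNReal.toReal_ofReal (by linarith)]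
  refine memLp_glue (measurable_pieceFun p K) hp0 hpt ?_
  have he : ∀ j, ∫⁻ x, ‖pieceFun p K j x‖ₑ ^ p.toReal =
      ENNReal.ofReal (((K (blockIndex K j) : ℝ) ^ (2 * q))⁻¹) := by
    intro j
    rw [← integral_pieceFun hq hp, ofReal_integral_eq_lintegral_ofReal]
    · refine lintegral_congr fun x => ?_
      rw [sq_rpow_eq, hP, ← Real.norm_eq_abs, ← ofReal_norm,
        ENNReal.ofReal_rpow_of_nonneg (norm_nonneg _) (by linarith)]
    · exact integrable_sq_rpow hq (memLp_pieceFun _ _ _ _)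
    · exact Filter.Eventually.of_forall fun _ => Real.rpow_nonneg (sq_nonneg _) _
  simp only [he]
  exact (summable_block hK hK2).tsum_ofReal_ne_top

/-- The block vectors `K n ^ (-1) * ∑ j, f_j`, where `j` runs over the `n`-th block. -/
def blockVec (h : MemLp (glue (pieceFun p K)) p volume) (n : ℕ) : Lp ℝ p (volume : Measure ℝ) :=
  ∑ j ∈ Finset.Ico (blockStart K n) (blockStart K (n + 1)),
    (K (blockIndex K j) : ℝ)⁻¹ • glueTranslate h j

theorem sum_blockVec (hK : ∀ n, 1 ≤ K n) (h : MemLp (glue (pieceFun p K)) p volume) (N : ℕ)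
    (c : ℕ → ℝ) : ∑ n ∈ Finset.range N, c n • blockVec h n =
      ∑ j ∈ Finset.range (blockStart K N),
        (c (blockIndex K j) * (K (blockIndex K j) : ℝ)⁻¹) • glueTranslate h j := by
  rw [sum_range_blockStart hK]
  refine Finset.sum_congr rfl fun n _ => ?_
  rw [blockVec, Finset.smul_sum]
  refine Finset.sum_congr rfl fun j hj => ?_
  rw [blockIndex_eq hK hj, smul_smul]

/-- Why blocks have length `K n ^ 4`: each index contributes `(K n)⁻¹ ^ 2` from the block
coefficient and again from the piece, and the length cancels both. -/
theorem sum_sq_pieceFun (hK : ∀ n, 1 ≤ K n) (N : ℕ) (c : ℕ → ℝ) (x : ℝ) :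
    ∑ j ∈ Finset.range (blockStart K N),
      (c (blockIndex K j) * (K (blockIndex K j) : ℝ)⁻¹ * pieceFun p K j x) ^ 2 =
      ∑ n ∈ Finset.range N, (c n * unitHaar p n x) ^ 2 := by
  simp only [mul_pow, pieceFun_sq]
  rw [sum_range_blockStart_blockIndex hK
    (fun n => c n ^ 2 * (K n : ℝ)⁻¹ ^ 2 * ((K n : ℝ)⁻¹ ^ 2 * unitHaar p n x ^ 2))]
  refine Finset.sum_congr rfl fun n _ => ?_
  have : (K n : ℝ) ≠ 0 := by have := hK n; positivity
  field_simp

/-- One term of the square function already has integral |c_n|^p, as the Haar functions are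
normalized. -/
theorem sq_rpow_le_integral [Fact (1 ≤ p)] (hq : 3 / 2 ≤ q) (hp : p = ENNReal.ofReal (2 * q))
    {N n : ℕ} (hn : n < N) (c : ℕ → ℝ) :
    (c n ^ 2) ^ q ≤ ∫ x, (∑ n ∈ Finset.range N, (c n * unitHaar p n x) ^ 2) ^ q := by
  have hq0 : 0 < q := by linarith
  have h1 : (c n ^ 2) ^ q = ∫ x, ((c n * unitHaar p n x) ^ 2) ^ q := by
    simp only [mul_pow]
    simp only [Real.mul_rpow (sq_nonneg _) (sq_nonneg _)]
    rw [integral_const_mul, integral_unitHaar hq0 hp, mul_one]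
  rw [h1]
  refine integral_mono (integrable_sq_rpow hq0 ((memLp_unitHaar p _ n).const_mul _))
    (integrable_sum_sq_rpow_finset hq (fun k => memLp_unitHaar p _ k) _ c) fun x => ?_
  refine Real.rpow_le_rpow (sq_nonneg _) ?_ hq0.le
  exact Finset.single_le_sum (f := fun n => (c n * unitHaar p n x) ^ 2)
    (fun i _ => sq_nonneg _) (Finset.mem_range.2 hn)

/-- Every tail mass is at most ‖f‖^p, so block n contributes at most K_n^(4-p) |c_n|^p ‖f‖^p; each
|c_n|^p is at most the square function integral, and a geometric series remains. -/
theorem sum_tailMass_le [Fact (1 ≤ p)] (hq : 3 / 2 ≤ q) (hp : p = ENNReal.ofReal (2 * q))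
    (hK : ∀ n, 1 ≤ K n)
    (hK2 : ∀ n, (K n : ℝ) ^ 4 * ((K n : ℝ) ^ (2 * q))⁻¹ ≤ (1 / 2) ^ n)
    (h : MemLp (glue (pieceFun p K)) p volume) (N : ℕ) (c : ℕ → ℝ) :
    ∑ j ∈ Finset.range (blockStart K N),
      ((c (blockIndex K j) * (K (blockIndex K j) : ℝ)⁻¹) ^ 2) ^ q * tailMass (pieceFun p K) q j ≤
    2 * (∫ x, (glue (pieceFun p K) x ^ 2) ^ q) *
      ∫ x, (∑ n ∈ Finset.range N, (c n * unitHaar p n x) ^ 2) ^ q := by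
  have hq0 : 0 < q := by linarith
  set κ := ∫ x, (glue (pieceFun p K) x ^ 2) ^ q with hκ
  set Z := ∫ x, (∑ n ∈ Finset.range N, (c n * unitHaar p n x) ^ 2) ^ q with hZ
  have hκ0 : 0 ≤ κ := integral_nonneg fun _ => Real.rpow_nonneg (sq_nonneg _) _
  have hZ0 : 0 ≤ Z := integral_nonneg fun _ =>
    Real.rpow_nonneg (Finset.sum_nonneg fun _ _ => sq_nonneg _) _
  calc _ ≤ ∑ j ∈ Finset.range (blockStart K N),
        ((c (blockIndex K j) * (K (blockIndex K j) : ℝ)⁻¹) ^ 2) ^ q * κ := by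
        refine Finset.sum_le_sum fun j _ => ?_
        refine mul_le_mul_of_nonneg_left ?_ (Real.rpow_nonneg (sq_nonneg _) _)
        exact tailMass_le hq0 (hp ▸ h) j
    _ = ∑ n ∈ Finset.range N, (K n : ℝ) ^ 4 * (((c n * (K n : ℝ)⁻¹) ^ 2) ^ q * κ) :=
        sum_range_blockStart_blockIndex hK (fun n => ((c n * (K n : ℝ)⁻¹) ^ 2) ^ q * κ) N
    _ ≤ ∑ n ∈ Finset.range N, (1 / 2 : ℝ) ^ n * (Z * κ) := by
        refine Finset.sum_le_sum fun n hn => ?_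
        have h1 := sq_rpow_le_integral hq hp (Finset.mem_range.1 hn) c
        rw [mul_pow, Real.mul_rpow (sq_nonneg _) (sq_nonneg _), inv_sq_rpow (by positivity)]
        calc (K n : ℝ) ^ 4 * ((c n ^ 2) ^ q * ((K n : ℝ) ^ (2 * q))⁻¹ * κ)
            = ((K n : ℝ) ^ 4 * ((K n : ℝ) ^ (2 * q))⁻¹) * ((c n ^ 2) ^ q * κ) := by ring
          _ ≤ (1 / 2 : ℝ) ^ n * (Z * κ) := by
            refine mul_le_mul (hK2 n) (mul_le_mul_of_nonneg_right h1 hκ0) ?_ (by positivity)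
            exact mul_nonneg (Real.rpow_nonneg (sq_nonneg _) _) hκ0
    _ ≤ 2 * (Z * κ) := by
        rw [← Finset.sum_mul]
        exact mul_le_mul_of_nonneg_right (sum_geometric_two_le N) (mul_nonneg hZ0 hκ0)
    _ = _ := by ring

/-- Block sums and Haar sums share the square function integral Z. Above, the norm formula gives (S
+ 2κ) Z and Z costs another S; below, the tails are dropped. -/
theorem seqEquivalent_blockVec [Fact (1 ≤ p)] (hq : 3 / 2 ≤ q) (hp : p = ENNReal.ofReal (2 * q))
    (hK : ∀ n, 1 ≤ K n) (hK2 : ∀ n, (K n : ℝ) ^ 4 * ((K n : ℝ) ^ (2 * q))⁻¹ ≤ (1 / 2) ^ n)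
    (h : MemLp (glue (pieceFun p K)) p volume) :
    SeqEquivalent (blockVec h) (normalizedHaar p) := by
  have hq0 : 0 < q := by linarith
  have hP : 0 < 2 * q := by linarith
  set S := squareConst q
  have hS : 0 < S := squareConst_pos hq
  set κ := ∫ x, (glue (pieceFun p K) x ^ 2) ^ q with hκ
  have hκ0 : 0 ≤ κ := integral_nonneg fun _ => Real.rpow_nonneg (sq_nonneg _) _
  have hM : 0 ≤ (S + 2 * κ) * S := by positivity
  refine ⟨((S + 2 * κ) * S) ^ (2 * q)⁻¹, fun N c => ?_⟩
  set Z := ∫ x, (∑ n ∈ Finset.range N, (c n * unitHaar p n x) ^ 2) ^ q with hZ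
  have hZ0 : 0 ≤ Z := integral_nonneg fun _ =>
    Real.rpow_nonneg (Finset.sum_nonneg fun _ _ => sq_nonneg _) _
  obtain ⟨hH1, hH2⟩ := (signSymmetric_unitHaar p).square_function_finset hq
    (fun k => memLp_unitHaar p _ k) (Finset.range N) c
  obtain ⟨hB1, hB2⟩ := (signSymmetric_pieceFun p K).square_function_finset hq
    (fun k => memLp_pieceFun p _ K k) (Finset.range (blockStart K N))
    (fun j => c (blockIndex K j) * (K (blockIndex K j) : ℝ)⁻¹)
  simp only [sum_sq_pieceFun hK] at hB1 hB2
  rw [← hZ] at hH1 hH2 hB1 hB2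
  have hT := sum_tailMass_le hq hp hK hK2 h N c
  rw [← hZ, ← hκ] at hT
  have hT0 : 0 ≤ ∑ j ∈ Finset.range (blockStart K N),
      ((c (blockIndex K j) * (K (blockIndex K j) : ℝ)⁻¹) ^ 2) ^ q * tailMass (pieceFun p K) q j :=
    Finset.sum_nonneg fun j _ =>
      mul_nonneg (Real.rpow_nonneg (sq_nonneg _) _) (tailMass_nonneg _ q j)
  rw [sum_blockVec hK]
  have eB := norm_sum_glueTranslate hq0 hp (fun j x hx => pieceFun_of_notMem p K j hx) h
    (Finset.range (blockStart K N)) (fun j => c (blockIndex K j) * (K (blockIndex K j) : ℝ)⁻¹)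
  have eH := norm_sum_normalizedHaar hq0 hp (Finset.range N) c
  rw [← eH] at hH1 hH2
  set X := ∫ x, ((∑ j ∈ Finset.range (blockStart K N),
    c (blockIndex K j) * (K (blockIndex K j) : ℝ)⁻¹ * pieceFun p K j x) ^ 2) ^ q with hX
  constructor
  · refine le_mul_of_rpow_le (norm_nonneg _) (norm_nonneg _) hM hP ?_
    rw [eB]
    calc _ ≤ (S + 2 * κ) * Z := by linarith
      _ ≤ (S + 2 * κ) * (S * ‖∑ n ∈ Finset.range N, c n • normalizedHaar p n‖ ^ (2 * q)) := by
        gcongr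
      _ = _ := by ring
  · refine le_mul_of_rpow_le (norm_nonneg _) (norm_nonneg _) hM hP ?_
    have hXB : X ≤ ‖∑ j ∈ Finset.range (blockStart K N),
        (c (blockIndex K j) * (K (blockIndex K j) : ℝ)⁻¹) • glueTranslate h j‖ ^ (2 * q) := by
      rw [eB]; linarith
    have hX0 : 0 ≤ X := integral_nonneg fun _ => Real.rpow_nonneg (sq_nonneg _) _
    calc _ ≤ S * (S * X) := hH2.trans (by gcongr)
      _ ≤ (S + 2 * κ) * S * X := by
        have : 0 ≤ 2 * κ * S * X := by positivity
        linarith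
      _ ≤ _ := by gcongr

theorem SeqEquivalent.ne_zero {E F : Type*} [NormedAddCommGroup E] [NormedSpace ℝ E]
    [NormedAddCommGroup F] [NormedSpace ℝ F] {x : ℕ → E} {y : ℕ → F} (h : SeqEquivalent x y)
    {n : ℕ} (hn : y n ≠ 0) : x n ≠ 0 := by
  obtain ⟨C, hC⟩ := h
  intro hx
  have h1 := (hC (n + 1) (Pi.single n 1)).2
  rw [Finset.sum_eq_single_of_mem n (by simp) fun i _ hi => by simp [Pi.single_eq_of_ne hi],
    Finset.sum_eq_single_of_mem n (by simp) fun i _ hi => by simp [Pi.single_eq_of_ne hi], hx] at h1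
  simp only [Pi.single_eq_same, one_smul, norm_zero, mul_zero, norm_le_zero_iff] at h1
  exact hn h1

theorem glueTranslate_ne_zero [Fact (1 ≤ p)] (hq : 0 < q) (hp : p = ENNReal.ofReal (2 * q))
    (hK : ∀ n, 1 ≤ K n)
    (h : MemLp (glue (pieceFun p K)) p volume) (j : ℕ) : glueTranslate h j ≠ 0 := by
  intro h0
  have e := norm_sum_glueTranslate hq hp (fun j x hx => pieceFun_of_notMem p K j hx) h {j} 1
  simp only [Finset.sum_singleton, Pi.one_apply, one_smul, one_mul, h0, norm_zero, one_pow,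
    Real.one_rpow] at e
  rw [Real.zero_rpow (by linarith), integral_pieceFun hq hp] at e
  have h1 := tailMass_nonneg (pieceFun p K) q j
  have h2 : 0 < ((K (blockIndex K j) : ℝ) ^ (2 * q))⁻¹ := by
    have : (0 : ℝ) < K (blockIndex K j) := by exact_mod_cast hK _
    positivity
  linarith

end

/-- The set `{-3 ^ j : j ≥ 1}` of translations, enumerated by `ℕ`. -/
def negThreePowEquiv : ℕ ≃ {l : ℤ | ∃ j : ℕ, 1 ≤ j ∧ l = -(3 ^ j)} :=
  Equiv.ofBijective (fun j => ⟨-(3 ^ (j + 1)), j + 1, by omega, rfl⟩) <| by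
    constructor
    · intro i j h
      exact injective_three_pow (neg_injective (congrArg Subtype.val h))
    · rintro ⟨_, j, hj, rfl⟩
      exact ⟨j - 1, Subtype.ext (by simp only [Nat.sub_add_cancel hj])⟩

end LpTranslates

end


/-! ### Assembly of the theorem -/

open LpTranslates
theorem theorem2p13 (p : ℝ≥0∞) [Fact (1 ≤ p)] (hp : 4 < p) (hp' : p < ∞) :
    ∃ (f : Lp ℝ p (volume : Measure ℝ)) (Λ : Set ℤ),
      Λ = {l : ℤ | ∃ j : ℕ, 1 ≤ j ∧ l = -(3 ^ j)} ∧
      IsUnconditionalBasic (fun l : Λ => translateLp f ((l : ℤ) : ℝ)) ∧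
      ∃ b : ℕ → Lp ℝ p (volume : Measure ℝ),
        IsBlockBasis (fun j : ℕ => translateLp f (-(3 ^ (j + 1)))) b ∧
        SeqEquivalent b (normalizedHaar p) ∧
        closedSpan b ≤ translateSpan f Λ ∧
        Nonempty (Lp ℝ p (volume : Measure ℝ) ≃L[ℝ] closedSpan b) := by
  -- With p = 2q, |u|^p is written `(u ^ 2) ^ q`, the form used in the square function estimates.
  obtain ⟨q, hpq⟩ : ∃ q : ℝ, p = ENNReal.ofReal (2 * q) :=
    ⟨p.toReal / 2, by rw [mul_div_cancel₀ _ two_ne_zero, ENNReal.ofReal_toReal hp'.ne]⟩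
  have hq : 4 < 2 * q := by
    rw [hpq] at hp
    simpa using (ENNReal.lt_ofReal_iff_toReal_lt (by simp)).1 hp
  have hq0 : 0 < q := by linarith
  have hq1 : 3 / 2 ≤ q := by linarith
  obtain ⟨K, hK, hK2⟩ := exists_block_sizes hq
  have h := memLp_glue_pieceFun hq0 hpq hK hK2
  have hcast : ∀ j, translateLp (h.toLp (glue (pieceFun p K))) ((negThreePowEquiv j : ℤ) : ℝ) =
      glueTranslate h j := fun j => by
    have : ((negThreePowEquiv j : ℤ) : ℝ) = -(3 ^ (j + 1)) := by
      change (((-(3 ^ (j + 1)) : ℤ)) : ℝ) = _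
      push_cast
      rfl
    rw [this, glueTranslate]
  have hequiv := seqEquivalent_blockVec hq1 hpq hK hK2 h
  refine ⟨h.toLp (glue (pieceFun p K)), _, rfl, ?_, blockVec h, ?_, hequiv, ?_, ?_⟩
  · refine isUnconditionalBasic_of_norm_sum_le (fun l => ?_)
      (C := (max 1 (squareConst q ^ 2)) ^ (2 * q)⁻¹) fun A B a hAB => ?_
    · obtain ⟨j, rfl⟩ := negThreePowEquiv.surjective l
      rw [hcast]
      exact glueTranslate_ne_zero hq0 hpq hK h j
    -- Finite subsets of Λ are carried to finite subsets of ℕ, where the order needed for sign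
    -- symmetry lives.
    · have e : ∀ A : Finset {l : ℤ | ∃ j : ℕ, 1 ≤ j ∧ l = -(3 ^ j)},
          ∑ l ∈ A, a l • translateLp (h.toLp (glue (pieceFun p K))) ((l : ℤ) : ℝ) =
          ∑ j ∈ A.map negThreePowEquiv.symm.toEmbedding,
            a (negThreePowEquiv j) • glueTranslate h j := fun A => by
        rw [Finset.sum_map]
        refine Finset.sum_congr rfl fun l _ => ?_
        rw [← hcast]
        simp
      rw [e, e]
      exact norm_sum_glueTranslate_le_of_subset (signSymmetric_pieceFun p K) hq1 hpq
        (memLp_pieceFun p p K) (fun j x hx => pieceFun_of_notMem p K j hx) h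
        (Finset.map_subset_map.2 hAB) (fun j => a (negThreePowEquiv j))
  -- The blocks are nonzero because they are equivalent to a sequence of unit vectors.
  · refine ⟨blockStart K, fun j => (K (blockIndex K j) : ℝ)⁻¹, strictMono_blockStart hK,
      fun n => ⟨hequiv.ne_zero ?_, rfl⟩⟩
    rw [← norm_ne_zero_iff, norm_normalizedHaar]
    exact one_ne_zero
  · refine Submodule.topologicalClosure_minimal _ ?_ (Submodule.isClosed_topologicalClosure _)
    rw [Submodule.span_le]
    rintro _ ⟨n, rfl⟩
    refine Submodule.sum_mem _ fun j _ => Submodule.smul_mem _ _ ?_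
    rw [← hcast]
    exact mem_closedSpan (fun l : {l : ℤ | ∃ j : ℕ, 1 ≤ j ∧ l = -(3 ^ j)} =>
      translateLp (h.toLp (glue (pieceFun p K))) ((l : ℤ) : ℝ)) (negThreePowEquiv j)
  · obtain ⟨e₁⟩ := exists_equiv_closedSpan_normalizedHaar (p := p) hp'.ne
    obtain ⟨e₂⟩ := hequiv.exists_equiv_closedSpan
    exact ⟨e₁.trans e₂.symm⟩
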